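/- Let $G$ be an infinite computable group, that is, a countable group whose elements are identified with the natural numbers in such a way that $0$ is the identity and the multiplication is a computable function $\mathbb N^2\to\mathbb N$. Let $C$ denote plain Kolmogorov complexity (with respect to any fixed additively optimal partial computable decompressor), applied to finite subsets of $G=\mathbb N$ and to words, i.e. maps $w:B\to A$ with $B\subset G$ finite, through computable encodings by natural numbers (a word is encoded by the pair consisting of its domain and the list of its letters in increasing order of positions). Suppose $G$ is amenable and let $(F_n)$ be a modest Følner sequence: the $F_n$ are nonempty finite subsets of $G$ with $$\lim_{n\to\infty}\frac{|F_ng\,\Delta\,F_n|}{|F_n|}=0\ \text{ for every } g\in G,\qquad \lim_{n\to\infty}\frac{C(F_n)}{|F_n|}=0 .$$ Let $A$ be a finite alphabet and let $\tau:A^G\to A^G$ be a cellular automaton, i.e. there are a finite set $S\subset G$ and a map $\mu:A^S\to A$ with $\tau(x)(g)=\mu\big((g^{-1}x)|_S\big)$ for all $x\in A^G$, $g\in G$, where $(gx)(g')=x(g^{-1}g')$. For $X\subset A^G$ and $x\in A^G$ put $$h(X)=\limsup_{n\to\infty}\frac{\log_2\big|\{y|_{F_n}: y\in X\}\big|}{|F_n|},\qquad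 hc(x)=\limsup_{n\to\infty}\frac{C(x|_{F_n})}{|F_n|}.$$ Then the following are equivalent: 1. $\tau$ has no Garden of Eden configuration, i.e. no $x\in A^G$ with $\tau^{-1}(x)=\varnothing$; 2. $\tau$ is pre-injective: if $x,y\in A^G$ coincide outside a finite set and $\tau(x)=\tau(y)$, then $x=y$; 3. $h(\tau(A^G))=h(A^G)$; 4. $hc(\tau(x))=hc(x)$ for every $x\in A^G$. -/

import Mathlib

open Filter Topology

noncomputable section

namespace AsymptoticComplexity

/-! ### Computable groups and Følner sequences -/

/-- `ν` identifies the underlying set of `G` with `ℕ` so that the transported group structure on `ℕ`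
has identity `0` and computable multiplication: `G`, seen on `ℕ` through `ν`, is a computable group.
Since `ν` is a bijection onto `ℕ`, such a `G` is infinite. -/
structure IsComputableGroup (G : Type*) [Group G] (ν : G ≃ ℕ) : Prop where
  map_one : ν 1 = 0
  computable_mul : Computable₂ fun m n : ℕ => ν (ν.symm m * ν.symm n)

/-- A (right) Følner sequence: nonempty finite sets `F n` with `|F n g ∆ F n| / |F n| → 0` for
every `g`. -/
def IsFolnerSequence {G : Type*} [Group G] [DecidableEq G] (F : ℕ → Finset G) : Prop :=
  (∀ n, (F n).Nonempty) ∧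
    ∀ g : G, Tendsto
      (fun n => ((symmDiff ((F n).map (mulRightEmbedding g)) (F n)).card : ℝ) / (F n).card)
      atTop (𝓝 0)

/-! ### Plain Kolmogorov complexity -/

/-- `U` is an additively optimal (universal) partial computable decompressor: programs are binary
strings, outputs are natural numbers, and every partial computable decompressor `V` is simulated by
`U` with a constant overhead in program length. -/
def IsOptimalDecompressor (U : List Bool →. ℕ) : Prop :=
  Partrec U ∧ ∀ V : List Bool →. ℕ, Partrec V →
    ∃ c : ℕ, ∀ (p : List Bool) (x : ℕ), x ∈ V p → ∃ q : List Bool, x ∈ U q ∧ q.length ≤ p.length + c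

/-- Additively optimal decompressors exist: `U (1ᵏ 0 p)` runs the `k`-th program on `p`. -/
theorem exists_isOptimalDecompressor : ∃ U : List Bool →. ℕ, IsOptimalDecompressor U := by
  refine ⟨fun p => (Denumerable.ofNat Nat.Partrec.Code (p.takeWhile id).length).eval
    (Encodable.encode (p.drop ((p.takeWhile id).length + 1))), ?_, ?_⟩
  · have hk : Primrec fun p : List Bool => (p.takeWhile id).length :=
      Primrec.list_length.comp (Primrec.list_takeWhile Primrec.id)
    exact Nat.Partrec.Code.eval_part.comp
      ((Primrec.ofNat Nat.Partrec.Code).comp hk).to_comp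
      (Primrec.encode.comp
        (Primrec.list_drop.comp (Primrec.succ.comp hk) Primrec.id)).to_comp
  · intro V hV
    obtain ⟨c, hc⟩ := Nat.Partrec.Code.exists_code.1 hV
    refine ⟨Encodable.encode c + 1, fun p x hx => ?_⟩
    refine ⟨List.replicate (Encodable.encode c) true ++ false :: p, ?_, by simp; omega⟩
    have h1 : (List.replicate (Encodable.encode c) true ++ false :: p).takeWhile id =
        List.replicate (Encodable.encode c) true := by
      rw [List.takeWhile_append_of_pos (by simp)]
      simp
    have h2 : (List.replicate (Encodable.encode c) true ++ false :: p).drop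
        (Encodable.encode c + 1) = p := by
      rw [← List.drop_drop]
      simp
    simp only [h1, List.length_replicate, h2, Denumerable.ofNat_encode, hc]
    simpa using hx

/-- Plain complexity of `x` with respect to the decompressor `U`: the length of a shortest program
for `x` (for an optimal `U` every `x` has a program). -/
def plainComplexity (U : List Bool →. ℕ) (x : ℕ) : ℕ :=
  sInf {n : ℕ | ∃ p : List Bool, p.length = n ∧ x ∈ U p}

section Words

variable {G A : Type*}

/-- The elements of the finite set `B`, as natural numbers, in increasing order. -/
def sortedList (ν : G ≃ ℕ) (B : Finset G) : List ℕ :=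
  (B.map ν.toEmbedding).sort (· ≤ ·)

/-- The complexity `C(B)` of a finite subset `B` of `G`. -/
def setComplexity (U : List Bool →. ℕ) (ν : G ≃ ℕ) (B : Finset G) : ℕ :=
  plainComplexity U (Encodable.encode (sortedList ν B))

/-- The content of the word `x|_B`: its (numbered) letters, listed in the increasing order of their
positions. -/
def content [Encodable A] (ν : G ≃ ℕ) (x : G → A) (B : Finset G) : List ℕ :=
  (sortedList ν B).map fun n => Encodable.encode (x (ν.symm n))

/-- The complexity `C(x|_B)` of the word `x|_B : B → A`, i.e. of the pair consisting of its domain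
`B` and its content. -/
def wordComplexity [Encodable A] (U : List Bool →. ℕ) (ν : G ≃ ℕ) (x : G → A) (B : Finset G) : ℕ :=
  plainComplexity U (Encodable.encode (sortedList ν B, content ν x B))

/-- A modest Følner sequence: a Følner sequence with `C(F n) = o(|F n|)`. -/
def IsModestFolnerSequence [Group G] [DecidableEq G] (U : List Bool →. ℕ) (ν : G ≃ ℕ)
    (F : ℕ → Finset G) : Prop :=
  IsFolnerSequence F ∧
    Tendsto (fun n => (setComplexity U ν (F n) : ℝ) / (F n).card) atTop (𝓝 0)

/-- The asymptotic Kolmogorov complexity `hc(x) = limsup C(x|_{F n}) / |F n|`. -/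
def asymptoticComplexity [Encodable A] (U : List Bool →. ℕ) (ν : G ≃ ℕ) (F : ℕ → Finset G)
    (x : G → A) : EReal :=
  limsup (fun n => (((wordComplexity U ν x (F n) : ℝ) / (F n).card : ℝ) : EReal)) atTop

/-- The entropy `h(X) = limsup log₂ |X|_{F n}| / |F n|` of a (nonempty) set `X` of configurations,
where `X|_B` is the set of restrictions to `B` of the elements of `X`. -/
def entropy (F : ℕ → Finset G) (X : Set (G → A)) : EReal :=
  limsup (fun n =>
    ((Real.logb 2 (((F n).restrict (π := fun _ => A)) '' X).ncard / (F n).card : ℝ) : EReal)) atTop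

/-! ### Cellular automata -/

/-- The left action of `G` on configurations: `(g x)(g') = x(g⁻¹ g')`. -/
def shift [Group G] (g : G) (x : G → A) : G → A := fun g' => x (g⁻¹ * g')

/-- `τ` is a cellular automaton: there are a finite memory set `S` and a rule `μ : A^S → A` with
`τ(x)(g) = μ((g⁻¹ x)|_S)`. -/
def IsCellularAutomaton [Group G] (τ : (G → A) → (G → A)) : Prop :=
  ∃ (S : Finset G) (μ : (S → A) → A), ∀ (x : G → A) (g : G), τ x g = μ (S.restrict (shift g⁻¹ x))

/-- `x` is a Garden of Eden configuration of `τ`: it has no preimage. -/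
def IsGardenOfEden (τ : (G → A) → (G → A)) (x : G → A) : Prop :=
  τ ⁻¹' {x} = ∅

/-- `τ` is pre-injective: two configurations that coincide outside a finite set and have the same
image are equal. -/
def IsPreInjective (τ : (G → A) → (G → A)) : Prop :=
  ∀ x y : G → A, (∃ B : Finset G, ∀ g, g ∉ B → x g = y g) → τ x = τ y → x = y

end Words

end AsymptoticComplexity

end

/-! For a finite set `B`, the word `τ(x)|_B` is determined by `x|_B` together with `x` on the
`S`-boundary of `B`, and the Følner condition makes that boundary negligible: only `o(|F n|)`
letters. If `τ` is pre-injective the converse holds as well: `x|_B` is determined by `τ(x)|_B` and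
the boundary letters (`IsPreInjective.restrict_eq`). Counting words turns this into equality of
entropies (2 → 3). Describing a word by the other one plus an index among the `|A|^o(|F n|)`
candidates turns it into equality of complexities (2 → 4); the candidates can be listed by an
algorithm (`IsCellularAutomaton.exists_computable_pairs`,
`IsOptimalDecompressor.exists_le_of_mem_list`).

For 3 → 1 and 3 → 2 the key is `IsFolnerSequence.entropy_lt`: forbidding one pattern on a positive
density of disjoint tiles costs a positive amount of entropy. If `τ` is not surjective, compactness
gives a pattern that no image shows anywhere. If `τ` is not pre-injective, one of two
interchangeable patterns can be replaced by the other on every tile, so the configurations avoiding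
it already have all the images. The implication 1 → 3 is immediate.

For 4 → 3, a Baire category argument yields `x` with `hc(x) ≥ log₂ |A|`. Since `τ(x)|_B` is
described by `B` and an index among the words of the image, modesty gives `hc(τ(x)) ≤ h(τ(A^G))`,
whence `h(A^G) = log₂ |A| ≤ hc(x) = hc(τ(x)) ≤ h(τ(A^G))`. -/

namespace AsymptoticComplexity

/-! ### Computability of list operations -/

section Computability

/-- All lists of length `n` with entries in `l`. -/
def words {α : Type*} (l : List α) (n : ℕ) : List (List α) :=
  n.rec [[]] fun _ ws => ws.flatMap fun w => l.map fun a => a :: w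

theorem mem_words {α : Type*} {l : List α} {n : ℕ} {w : List α} :
    w ∈ words l n ↔ w.length = n ∧ ∀ a ∈ w, a ∈ l := by
  induction n generalizing w with
  | zero => simp +contextual [words, List.length_eq_zero_iff]
  | succ n ih =>
    have : words l (n + 1) = (words l n).flatMap fun w => l.map fun a => a :: w := rfl
    rw [this, List.mem_flatMap]
    cases w with
    | nil => simp
    | cons b w =>
      simp only [List.mem_map, List.cons.injEq, List.length_cons, List.mem_cons, forall_eq_or_imp,
        Nat.add_right_cancel_iff]
      constructor
      · rintro ⟨v, hv, a, ha, rfl, rfl⟩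
        exact ⟨(ih.1 hv).1, ha, (ih.1 hv).2⟩
      · rintro ⟨h1, h2, h3⟩
        exact ⟨w, ih.2 ⟨h1, h3⟩, b, h2, rfl, rfl⟩

variable {α β : Type*} [Primcodable α] [Primcodable β]

/-- The multiplication of `G` is computable but perhaps not primitive recursive, so the map is built
by recursion on initial segments of the list. -/
theorem computable_list_map {f : α → β} (hf : Computable f) : Computable (List.map f) := by
  have h : Computable fun l : List α => Nat.rec (motive := fun _ => List β) []
      (fun n acc => Option.casesOn (motive := fun _ => List β) l[n]? acc
        fun a => acc ++ [f a]) l.length := by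
    refine Computable.nat_rec (α := List α) (σ := List β)
      (h := fun l x => Option.casesOn (motive := fun _ => List β) l[x.1]? x.2
        fun a => x.2 ++ [f a]) Computable.list_length (Computable.const ([] : List β)) ?_
    refine Computable.option_casesOn
      (Computable.list_getElem?.comp Computable.fst (Computable.fst.comp Computable.snd))
      (Computable.snd.comp Computable.snd) ?_
    exact Computable.list_concat.comp
      (Computable.snd.comp (Computable.snd.comp Computable.fst)) (hf.comp Computable.snd)
  refine h.of_eq fun l => ?_
  have key : ∀ n ≤ l.length, (Nat.rec (motive := fun _ => List β) []
      (fun n acc => Option.casesOn (motive := fun _ => List β) l[n]? acc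
        fun a => acc ++ [f a]) n) = (l.take n).map f := by
    intro n hn
    induction n with
    | zero => simp
    | succ n ih =>
      have hl : l[n]? = some l[n] := List.getElem?_eq_getElem (by omega)
      simp only [ih (by omega), hl]
      rw [← List.take_concat_get' l n (by omega), List.map_append]
      rfl
  simpa using key l.length le_rfl

/-- `l ∪ []` is `l` without repetitions. Indexing into it costs the logarithm of the number of
distinct values, whatever the length of `l`. -/
theorem primrec_list_union_nil [DecidableEq α] : Primrec fun l : List α => l ∪ [] := by
  have hmem : PrimrecRel fun (l : List α) (a : α) => ∃ b ∈ l, b = a :=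
    PrimrecRel.exists_mem_list Primrec.eq
  have h : Primrec fun l : List α =>
      l.foldr (fun a acc => if ∃ b ∈ acc, b = a then acc else a :: acc) [] := by
    refine Primrec.list_foldr (α := List α)
      (h := fun _ x => if ∃ b ∈ x.2, b = x.1 then x.2 else x.1 :: x.2)
      Primrec.id (Primrec.const ([] : List α)) ?_
    refine Primrec.ite (hmem.comp (Primrec.snd.comp Primrec.snd) (Primrec.fst.comp Primrec.snd))
      (Primrec.snd.comp Primrec.snd)
      (Primrec.list_cons.comp (Primrec.fst.comp Primrec.snd) (Primrec.snd.comp Primrec.snd))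
  refine h.of_eq fun l => ?_
  induction l with
  | nil => rfl
  | cons a l ih =>
    rw [List.foldr_cons, ih, List.cons_union]
    by_cases ha : a ∈ l ∪ [] <;> simp [List.insert, ha]

/-- Functions with a finite domain are restrictions of primitive recursive functions. -/
theorem exists_primrec_extension {ι : Type*} [Finite ι] [DecidableEq α] (e : ι → α)
    (f : ι → ℕ) (hef : ∀ i j, e i = e j → f i = f j) :
    ∃ r : α → ℕ, Primrec r ∧ ∀ i, r (e i) = f i := by
  cases nonempty_fintype ι
  let l : List ι := Finset.univ.toList
  refine ⟨fun a => (l.map f).getD ((l.map e).idxOf a) 0,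
    (Primrec.list_getD 0).comp (Primrec.const _) (Primrec.list_idxOf₁ _), fun i => ?_⟩
  have hmem : e i ∈ l.map e := List.mem_map_of_mem (by simp [l])
  have hlt := List.idxOf_lt_length_of_mem hmem
  have hlt' : (l.map e).idxOf (e i) < l.length := by simpa using hlt
  have hget : (l.map e)[(l.map e).idxOf (e i)] = e i := List.getElem_idxOf hlt
  rw [List.getElem_map] at hget
  beta_reduce
  rw [List.getD_eq_getElem _ _ (by simpa using hlt'), List.getElem_map]
  exact hef _ _ hget

theorem primrec_words (l : List α) : Primrec (words l) := by
  refine Primrec.nat_rec₁ [[]] ?_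
  refine Primrec.list_flatMap Primrec.snd ?_
  refine Primrec.list_map (Primrec.const l) ?_
  exact Primrec.list_cons.comp Primrec.snd (Primrec.snd.comp Primrec.fst)

end Computability

/-! ### Upper bounds for the plain complexity -/

section Complexity

/-- The number with the binary digits `l`, the least significant digit first. -/
def bitsToNat (l : List Bool) : ℕ := l.foldr Nat.bit 0

theorem primrec_bitsToNat : Primrec bitsToNat := by
  refine Primrec.list_foldr (α := List Bool) (h := fun _ x => Nat.bit x.1 x.2)
    Primrec.id (Primrec.const 0) ?_
  have : Primrec₂ fun (b : Bool) (n : ℕ) => cond b (2 * n + 1) (2 * n) :=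
    Primrec.cond Primrec.fst
      (Primrec.succ.comp (Primrec.nat_mul.comp (Primrec.const 2) Primrec.snd))
      (Primrec.nat_mul.comp (Primrec.const 2) Primrec.snd)
  exact (this.comp (Primrec.fst.comp Primrec.snd) (Primrec.snd.comp Primrec.snd)).of_eq
    fun ⟨_, b, n⟩ => by cases b <;> rfl

theorem exists_bitsToNat_eq (j n : ℕ) (h : n < 2 ^ j) :
    ∃ l : List Bool, l.length = j ∧ bitsToNat l = n := by
  induction j generalizing n with
  | zero => exact ⟨[], rfl, by simp at h; simp [bitsToNat, h]⟩
  | succ j ih =>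
    obtain ⟨l, hl, hn⟩ := ih (n / 2) (by omega)
    refine ⟨n.bodd :: l, by simp [hl], ?_⟩
    have : bitsToNat (n.bodd :: l) = Nat.bit n.bodd (bitsToNat l) := rfl
    rw [this, hn, ← Nat.div2_val, Nat.bit_bodd_div2]

theorem plainComplexity_le {U : List Bool →. ℕ} {q : List Bool} {x : ℕ} (h : x ∈ U q) :
    plainComplexity U x ≤ q.length :=
  Nat.sInf_le ⟨q, rfl, h⟩

theorem IsOptimalDecompressor.exists_program {U : List Bool →. ℕ} (hU : IsOptimalDecompressor U)
    (x : ℕ) : ∃ p : List Bool, p.length = plainComplexity U x ∧ x ∈ U p := by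
  obtain ⟨c, hc⟩ := hU.2 (fun _ => Part.some x) (Computable.const x).partrec
  obtain ⟨q, hq, -⟩ := hc [] x (Part.mem_some x)
  exact Nat.sInf_mem (s := {n : ℕ | ∃ p : List Bool, p.length = n ∧ x ∈ U p}) ⟨_, q, rfl, hq⟩

/-- The pair is coded as `1^|p| 0 p q`: the unary prefix makes `p` self-delimiting and doubles its
cost, while `q` is charged only once. -/
theorem IsOptimalDecompressor.exists_le_of_pair {U : List Bool →. ℕ}
    (hU : IsOptimalDecompressor U) {V : List Bool → List Bool →. ℕ} (hV : Partrec₂ V) :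
    ∃ c, ∀ p q x, x ∈ V p q → plainComplexity U x ≤ 2 * p.length + q.length + c := by
  have hk : Primrec fun r : List Bool => (r.takeWhile id).length :=
    Primrec.list_length.comp (Primrec.list_takeWhile Primrec.id)
  have hd : Primrec fun r : List Bool => r.drop ((r.takeWhile id).length + 1) :=
    Primrec.list_drop.comp (Primrec.succ.comp hk) Primrec.id
  obtain ⟨c, hc⟩ := hU.2 (fun r =>
    V ((r.drop ((r.takeWhile id).length + 1)).take (r.takeWhile id).length)
      ((r.drop ((r.takeWhile id).length + 1)).drop (r.takeWhile id).length))
    (Partrec₂.comp hV (Primrec.list_take.comp hk hd).to_comp (Primrec.list_drop.comp hk hd).to_comp)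
  refine ⟨c + 1, fun p q x hx => ?_⟩
  have h1 : (List.replicate p.length true ++ false :: (p ++ q)).takeWhile id =
      List.replicate p.length true := by
    rw [List.takeWhile_append_of_pos (by simp)]
    simp
  have h2 : (List.replicate p.length true ++ false :: (p ++ q)).drop (p.length + 1) = p ++ q := by
    rw [← List.drop_drop]
    simp
  obtain ⟨r, hr, hlen⟩ := hc (List.replicate p.length true ++ false :: (p ++ q)) x (by
    simpa only [h1, List.length_replicate, h2, List.take_left, List.drop_left] using hx)
  have := plainComplexity_le hr
  simp only [List.length_append, List.length_replicate, List.length_cons] at hlen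
  omega

/-- An element of a finite list computed from `y` is described by `y` and its index. -/
theorem IsOptimalDecompressor.exists_le_of_mem_list {U : List Bool →. ℕ}
    (hU : IsOptimalDecompressor U) {α β : Type*} [Primcodable α] [Primcodable β] [DecidableEq β]
    {T : α → List β} (hT : Computable T) :
    ∃ c, ∀ y, ∀ x ∈ T y,
      plainComplexity U (Encodable.encode x) ≤
        plainComplexity U (Encodable.encode y) + 2 * Nat.clog 2 (T y).toFinset.card + c ∧
      plainComplexity U (Encodable.encode x) ≤
        2 * plainComplexity U (Encodable.encode y) + Nat.clog 2 (T y).toFinset.card + c := by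
  let g : ℕ → ℕ → Option ℕ := fun n i =>
    (Encodable.decode (α := α) n).bind fun y => ((T y ∪ [])[i]?).map Encodable.encode
  have hg : Computable₂ g := by
    refine Computable.option_bind (Computable.decode.comp Computable.fst) ?_
    refine Computable.option_map ?_ (Computable.encode.comp Computable.snd).to₂
    exact Computable.list_getElem?.comp
      (primrec_list_union_nil.to_comp.comp (hT.comp Computable.snd))
      (Computable.snd.comp Computable.fst)
  have hb := primrec_bitsToNat.to_comp
  -- Either the index or the program for `y` can be the doubled component; `hV1` doubles the index,
  -- `hV2` the program. The doubled part is later the negligible one.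
  have hV1 : Partrec₂ fun (p q : List Bool) => (U q).bind fun n => (g n (bitsToNat p) : Part ℕ) := by
    refine Partrec.bind (hU.1.comp Computable.snd) ?_
    exact Computable.ofOption (hg.comp Computable.snd (hb.comp (Computable.fst.comp Computable.fst)))
  have hV2 : Partrec₂ fun (p q : List Bool) => (U p).bind fun n => (g n (bitsToNat q) : Part ℕ) := by
    refine Partrec.bind (hU.1.comp Computable.fst) ?_
    exact Computable.ofOption (hg.comp Computable.snd (hb.comp (Computable.snd.comp Computable.fst)))
  obtain ⟨c1, hc1⟩ := hU.exists_le_of_pair hV1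
  obtain ⟨c2, hc2⟩ := hU.exists_le_of_pair hV2
  refine ⟨c1 + c2, fun y x hx => ?_⟩
  obtain ⟨p, hp, hyp⟩ := hU.exists_program (Encodable.encode y)
  have hmem : x ∈ T y ∪ [] := by simpa using hx
  have hcard : (T y ∪ []).length = (T y).toFinset.card := by
    rw [← List.toFinset_card_of_nodup (List.Nodup.union _ List.nodup_nil)]
    congr 1
    ext
    simp
  have hlt := List.idxOf_lt_length_of_mem hmem
  obtain ⟨q, hq, hqx⟩ := exists_bitsToNat_eq (Nat.clog 2 (T y).toFinset.card)
    ((T y ∪ []).idxOf x) (by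
      rw [hcard] at hlt
      exact hlt.trans_le (Nat.le_pow_clog (by norm_num) _))
  have hgx : Encodable.encode x ∈ (g (Encodable.encode y) (bitsToNat q) : Part ℕ) := by
    rw [hqx, Part.mem_ofOption]
    simp [g, List.getElem?_eq_getElem hlt]
  have h1 := hc1 q p _ (Part.mem_bind hyp hgx)
  have h2 := hc2 p q _ (Part.mem_bind hyp hgx)
  rw [hp, hq] at h1 h2
  omega

end Complexity

/-! ### The computable list of pairs of words `(z|_B, τ(z)|_B)` -/

section Pairs

/-- The value at `m` of the assignment that sends the first occurrence of each entry of `l` to the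
corresponding entry of `w`. -/
def valueAt (l w : List ℕ) (m : ℕ) : ℕ := w.getD (l.idxOf m) 0

theorem primrec_valueAt : Primrec fun x : (List ℕ × List ℕ) × ℕ => valueAt x.1.1 x.1.2 x.2 :=
  (Primrec.list_getD 0).comp (Primrec.snd.comp Primrec.fst)
    (Primrec.list_idxOf.comp Primrec.snd (Primrec.fst.comp Primrec.fst))

theorem primrec_map_valueAt :
    Primrec fun x : (List ℕ × List ℕ) × List ℕ => x.2.map (valueAt x.1.1 x.1.2) :=
  Primrec.list_map Primrec.snd
    (primrec_valueAt.comp (Primrec.pair (Primrec.fst.comp Primrec.fst) Primrec.snd))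

/-- Given the table of neighbourhoods, everything is primitive recursive; only the table itself
needs the group. Positions may repeat in the concatenated list, which is harmless because `valueAt`
reads the first occurrence. -/
theorem primrec_pairs {r : List ℕ → ℕ} (hr : Primrec r) (abc : List ℕ) :
    Primrec fun x : List ℕ × List (List ℕ) =>
      (words abc (x.1 ++ x.2.flatten).length).map fun w =>
        (x.1.map (valueAt (x.1 ++ x.2.flatten) w),
          x.2.map fun row => r (row.map (valueAt (x.1 ++ x.2.flatten) w))) := by
  have hext : Primrec fun x : List ℕ × List (List ℕ) => x.1 ++ x.2.flatten :=
    Primrec.list_append.comp Primrec.fst (Primrec.list_flatten.comp Primrec.snd)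
  have h1 : Primrec fun x : (List ℕ × List (List ℕ)) × List ℕ =>
      (x.1.1 ++ x.1.2.flatten, x.2) := Primrec.pair (hext.comp Primrec.fst) Primrec.snd
  have h2 : Primrec fun x : (List ℕ × List (List ℕ)) × List ℕ =>
      x.1.1.map (valueAt (x.1.1 ++ x.1.2.flatten) x.2) :=
    primrec_map_valueAt.comp (Primrec.pair h1 (Primrec.fst.comp Primrec.fst))
  have h3 : Primrec fun x : ((List ℕ × List (List ℕ)) × List ℕ) × List ℕ =>
      r (x.2.map (valueAt (x.1.1.1 ++ x.1.1.2.flatten) x.1.2)) :=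
    hr.comp (primrec_map_valueAt.comp (Primrec.pair (h1.comp Primrec.fst) Primrec.snd))
  have h4 : Primrec fun x : (List ℕ × List (List ℕ)) × List ℕ =>
      x.1.2.map fun row => r (row.map (valueAt (x.1.1 ++ x.1.2.flatten) x.2)) :=
    Primrec.list_map (Primrec.snd.comp Primrec.fst) h3.to₂
  exact Primrec.list_map ((primrec_words abc).comp (Primrec.list_length.comp hext))
    (Primrec.pair h2 h4).to₂

theorem valueAt_mem {l w : List ℕ} (h : w.length = l.length) {m : ℕ} (hm : m ∈ l) :
    valueAt l w m ∈ w := by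
  have := List.idxOf_lt_length_of_mem hm
  rw [valueAt, List.getD_eq_getElem _ _ (by omega)]
  exact List.getElem_mem _

theorem valueAt_map {l : List ℕ} (f : ℕ → ℕ) {m : ℕ} (hm : m ∈ l) :
    valueAt l (l.map f) m = f m := by
  have := List.idxOf_lt_length_of_mem hm
  rw [valueAt, List.getD_eq_getElem _ _ (by simpa using this), List.getElem_map,
    List.getElem_idxOf]

theorem computable_map_mul {G : Type*} [Group G] {ν : G ≃ ℕ} (hG : IsComputableGroup G ν)
    (l : List G) : Computable fun m : ℕ => l.map fun s => ν (ν.symm m * s) := by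
  induction l with
  | nil => exact Computable.const []
  | cons s l ih =>
    refine (Computable.list_cons.comp
      (hG.computable_mul.comp Computable.id (Computable.const (ν s))) ih).of_eq fun m => ?_
    simp

/-- The word of `z` along the list of positions `l`. -/
def letters {G A : Type*} [Encodable A] (ν : G ≃ ℕ) (z : G → A) (l : List ℕ) : List ℕ :=
  l.map fun m => Encodable.encode (z (ν.symm m))

/-- Both words depend on `z` only at the positions in `l` and their `S`-neighbours. One runs through
all words on these finitely many positions and applies the local rule, which is a finite table. -/
theorem IsCellularAutomaton.exists_computable_pairs {G A : Type*} [Group G] {ν : G ≃ ℕ}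
    (hG : IsComputableGroup G ν) [Finite A] [Nonempty A] [Encodable A]
    {τ : (G → A) → (G → A)} (hτ : IsCellularAutomaton τ) :
    ∃ P : List ℕ → List (List ℕ × List ℕ), Computable P ∧ ∀ l c d,
      (c, d) ∈ P l ↔ ∃ z : G → A, letters ν z l = c ∧ letters ν (τ z) l = d := by
  classical
  obtain ⟨S, μ, hμ⟩ := hτ
  cases nonempty_fintype A
  let Sl : List S := Finset.univ.toList
  obtain ⟨r, hr, hrμ⟩ := exists_primrec_extension
    (fun u : S → A => Sl.map fun s => Encodable.encode (u s))
    (fun u => Encodable.encode (μ u)) (fun u v huv => by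
      have : u = v := by
        funext s
        have := List.map_inj_left.1 huv s (by simp [Sl])
        exact Encodable.encode_injective this
      rw [this])
  let abc : List ℕ := (Finset.univ : Finset A).toList.map Encodable.encode
  let tb : List ℕ → List (List ℕ) :=
    fun l => l.map fun m => Sl.map fun s : S => ν (ν.symm m * s)
  have htb : Computable tb := by
    refine computable_list_map ((computable_map_mul hG (Sl.map Subtype.val)).of_eq fun m => ?_)
    simp
  let ext : List ℕ → List ℕ := fun l => l ++ (tb l).flatten
  let pair : List ℕ → List ℕ → List ℕ × List ℕ := fun l w =>
    (l.map (valueAt (ext l) w), (tb l).map fun row => r (row.map (valueAt (ext l) w)))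
  have hpair : ∀ (l w : List ℕ) (z : G → A),
      (∀ m ∈ ext l, valueAt (ext l) w m = Encodable.encode (z (ν.symm m))) →
      pair l w = (letters ν z l, letters ν (τ z) l) := by
    intro l w z h
    refine Prod.ext (List.map_congr_left fun m hm => h m (List.mem_append_left _ hm)) ?_
    simp only [pair, tb, letters, List.map_map]
    refine List.map_congr_left fun m hm => ?_
    have hrow : (Sl.map fun s : S => ν (ν.symm m * s)).map (valueAt (ext l) w) =
        Sl.map fun s : S => Encodable.encode (z (ν.symm m * s)) := by
      rw [List.map_map]
      refine List.map_congr_left fun s hs => ?_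
      have := h (ν (ν.symm m * s)) (List.mem_append_right _ (List.mem_flatten.2
        ⟨_, List.mem_map_of_mem hm, List.mem_map_of_mem hs⟩))
      simpa using this
    rw [Function.comp_apply, hrow, hrμ, hμ]
    congr 2
    funext s
    simp [shift]
  refine ⟨fun l => (words abc (ext l).length).map (pair l), ?_, fun l c d => ?_⟩
  · exact (primrec_pairs hr abc).to_comp.comp (Computable.pair Computable.id htb)
  · rw [List.mem_map]
    constructor
    · rintro ⟨w, hw, hwcd⟩
      rw [mem_words] at hw
      obtain ⟨a₀⟩ := ‹Nonempty A›
      -- Off the listed positions the configuration is irrelevant; `a₀` fills it in.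
      let z : G → A := fun g => (Encodable.decode (valueAt (ext l) w (ν g))).getD a₀
      have hz := hpair l w z fun m hm => by
        have := hw.2 _ (valueAt_mem hw.1 hm)
        obtain ⟨a, -, ha⟩ := List.mem_map.1 this
        simp [z, ← ha]
      rw [hwcd] at hz
      exact ⟨z, (congrArg Prod.fst hz).symm, (congrArg Prod.snd hz).symm⟩
    · rintro ⟨z, rfl, rfl⟩
      refine ⟨(ext l).map fun m => Encodable.encode (z (ν.symm m)), mem_words.2 ⟨by simp, ?_⟩,
        hpair l _ z fun m hm => valueAt_map _ hm⟩
      intro a ha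
      obtain ⟨m, -, rfl⟩ := List.mem_map.1 ha
      exact List.mem_map_of_mem (by simp)

end Pairs

/-! ### Complexity of words and numbers of words -/

section Counting

/-- On `Z`, `f` factors through `g`. Finiteness matters because `ncard` is `0` on infinite sets. -/
theorem ncard_image_le_of_determines {ζ α β : Type*} {Z : Set ζ} (f : ζ → α) (g : ζ → β)
    (hfin : (g '' Z).Finite) (h : ∀ z ∈ Z, ∀ z' ∈ Z, g z = g z' → f z = f z') :
    (f '' Z).ncard ≤ (g '' Z).ncard := by
  classical
  rcases Z.eq_empty_or_nonempty with rfl | ⟨z₀, hz₀⟩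
  · simp
  let φ : β → α := fun b => if hb : b ∈ g '' Z then f hb.choose else f z₀
  have hφ : f '' Z ⊆ φ '' (g '' Z) := by
    rintro _ ⟨z, hz, rfl⟩
    have hb : g z ∈ g '' Z := ⟨z, hz, rfl⟩
    refine ⟨g z, hb, ?_⟩
    simp only [φ, dif_pos hb]
    exact h _ hb.choose_spec.1 _ hz hb.choose_spec.2
  exact (Set.ncard_le_ncard hφ (hfin.image φ)).trans (Set.ncard_image_le hfin)

variable {G A : Type*}

theorem ncard_restrict_image_le [Finite A] (B : Finset G) (Z : Set (B → A)) :
    Z.ncard ≤ Nat.card A ^ B.card := by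
  refine (Set.ncard_le_ncard (Set.subset_univ Z)).trans ?_
  rw [Set.ncard_univ, Nat.card_fun, Nat.card_eq_finsetCard]

theorem ncard_pair_image_le [Finite A] {ζ : Type*} (Z : Set ζ) (B E : Finset G) (f : ζ → B → A)
    (e : ζ → E → A) :
    ((fun z => (f z, e z)) '' Z).ncard ≤ (f '' Z).ncard * Nat.card A ^ E.card := by
  calc ((fun z => (f z, e z)) '' Z).ncard ≤ ((f '' Z) ×ˢ (e '' Z)).ncard :=
        Set.ncard_le_ncard (by rintro _ ⟨z, hz, rfl⟩; exact ⟨⟨z, hz, rfl⟩, ⟨z, hz, rfl⟩⟩)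
    _ = (f '' Z).ncard * (e '' Z).ncard := Set.ncard_prod
    _ ≤ _ := Nat.mul_le_mul_left _ (ncard_restrict_image_le _ _)

theorem ncard_restrict_image_univ [Nonempty A] (B : Finset G) :
    ((B.restrict (π := fun _ => A)) '' Set.univ).ncard = Nat.card A ^ B.card := by
  classical
  obtain ⟨a₀⟩ := ‹Nonempty A›
  have : (B.restrict (π := fun _ => A)) '' Set.univ = Set.univ := by
    refine Set.eq_univ_of_forall fun w =>
      ⟨fun g => if hg : g ∈ B then w ⟨g, hg⟩ else a₀, trivial, ?_⟩
    funext g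
    simp
  rw [this, Set.ncard_univ, Nat.card_fun, Nat.card_eq_finsetCard]

theorem mem_sortedList {ν : G ≃ ℕ} {B : Finset G} {m : ℕ} : m ∈ sortedList ν B ↔ ν.symm m ∈ B := by
  rw [sortedList, Finset.mem_sort, Finset.mem_map_equiv]

theorem letters_sortedList_eq_iff [Encodable A] {ν : G ≃ ℕ} {B : Finset G} {x y : G → A} :
    letters ν x (sortedList ν B) = letters ν y (sortedList ν B) ↔
      B.restrict (π := fun _ => A) x = B.restrict y := by
  rw [letters, letters, List.map_inj_left]
  constructor
  · intro h
    funext g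
    have := h (ν g) (mem_sortedList.2 (by simp))
    simpa using this
  · intro h m hm
    exact congrArg _ (congrFun h ⟨_, mem_sortedList.1 hm⟩)

/-- Elements of the form `(sortedList B, letters of z on B)` with `z|_B` in a set `W` are at most
as many as the elements of `W`. -/
theorem card_toFinset_le_ncard [Finite A] [Nonempty A] [Encodable A] (ν : G ≃ ℕ) (B : Finset G)
    (W : Set (B → A)) (t : List (List ℕ × List ℕ))
    (h : ∀ p ∈ t, ∃ z : G → A, B.restrict z ∈ W ∧
      p = (sortedList ν B, letters ν z (sortedList ν B))) :
    t.toFinset.card ≤ W.ncard := by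
  classical
  obtain ⟨a₀⟩ := ‹Nonempty A›
  let ext : (B → A) → G → A := fun w g => if hg : g ∈ B then w ⟨g, hg⟩ else a₀
  rw [← Set.ncard_coe_finset]
  refine (Set.ncard_le_ncard (t := (fun w =>
    (sortedList ν B, letters ν (ext w) (sortedList ν B))) '' W) ?_ (W.toFinite.image _)).trans
    (Set.ncard_image_le W.toFinite)
  intro p hp
  obtain ⟨z, hz, rfl⟩ := h p (by simpa using hp)
  refine ⟨B.restrict z, hz, Prod.ext rfl (letters_sortedList_eq_iff.2 ?_)⟩
  funext g
  simp [ext]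

variable [Group G] {ν : G ≃ ℕ} [Finite A] [Nonempty A] [Encodable A] {U : List Bool →. ℕ}
  {τ : (G → A) → (G → A)}

/-- `τ(x)|_B` is described by `x|_B` and its index among the possible values. -/
theorem exists_wordComplexity_image_le (hG : IsComputableGroup G ν) (hU : IsOptimalDecompressor U)
    (hτ : IsCellularAutomaton τ) :
    ∃ c, ∀ (B : Finset G) (x : G → A),
      wordComplexity U ν (τ x) B ≤ wordComplexity U ν x B + 2 * Nat.clog 2
        ((fun z => B.restrict (π := fun _ => A) (τ z)) ''
          {z | B.restrict (π := fun _ => A) z = B.restrict x}).ncard + c := by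
  obtain ⟨P, hP, hPmem⟩ := hτ.exists_computable_pairs hG
  have hT : Computable fun y : List ℕ × List ℕ => (P y.1).filterMap fun p =>
      if p.1 = y.2 then some (y.1, p.2) else none := by
    have : Primrec fun x : (List ℕ × List ℕ) × List (List ℕ × List ℕ) => x.2.filterMap fun p =>
        if p.1 = x.1.2 then some (x.1.1, p.2) else none := by
      refine Primrec.listFilterMap Primrec.snd (Primrec.ite ?_ ?_ ?_)
      · exact Primrec.eq.comp (Primrec.fst.comp Primrec.snd)
          (Primrec.snd.comp (Primrec.fst.comp Primrec.fst))
      · exact Primrec.option_some.comp (Primrec.pair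
          (Primrec.fst.comp (Primrec.fst.comp Primrec.fst)) (Primrec.snd.comp Primrec.snd))
      · exact Primrec.const none
    exact this.to_comp.comp (Computable.pair Computable.id (hP.comp Computable.fst))
  obtain ⟨c, hc⟩ := hU.exists_le_of_mem_list hT
  refine ⟨c, fun B x => ?_⟩
  -- The first bound is used: the doubled index ranges over few words, while the complexity of
  -- `x|_B` must keep coefficient one.
  have h := (hc (sortedList ν B, letters ν x (sortedList ν B))
    (sortedList ν B, letters ν (τ x) (sortedList ν B)) (by
      rw [List.mem_filterMap]
      exact ⟨_, (hPmem _ _ _).2 ⟨x, rfl, rfl⟩, by simp⟩)).1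
  refine h.trans ?_
  gcongr
  · exact le_rfl
  · refine card_toFinset_le_ncard ν B _ _ fun p hp => ?_
    obtain ⟨⟨c', d⟩, hcd, hp⟩ := List.mem_filterMap.1 hp
    obtain ⟨z, rfl, rfl⟩ := (hPmem _ _ _).1 hcd
    simp only [Option.ite_none_right_eq_some, Option.some.injEq] at hp
    exact ⟨τ z, ⟨z, letters_sortedList_eq_iff.1 hp.1, rfl⟩, hp.2.symm⟩

/-- `x|_B` is described by `τ(x)|_B` and its index among the possible values. -/
theorem exists_wordComplexity_le_image (hG : IsComputableGroup G ν) (hU : IsOptimalDecompressor U)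
    (hτ : IsCellularAutomaton τ) :
    ∃ c, ∀ (B : Finset G) (x : G → A),
      wordComplexity U ν x B ≤ wordComplexity U ν (τ x) B + 2 * Nat.clog 2
        ((fun z => B.restrict (π := fun _ => A) z) ''
          {z | B.restrict (π := fun _ => A) (τ z) = B.restrict (τ x)}).ncard + c := by
  obtain ⟨P, hP, hPmem⟩ := hτ.exists_computable_pairs hG
  have hT : Computable fun y : List ℕ × List ℕ => (P y.1).filterMap fun p =>
      if p.2 = y.2 then some (y.1, p.1) else none := by
    have : Primrec fun x : (List ℕ × List ℕ) × List (List ℕ × List ℕ) => x.2.filterMap fun p =>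
        if p.2 = x.1.2 then some (x.1.1, p.1) else none := by
      refine Primrec.listFilterMap Primrec.snd (Primrec.ite ?_ ?_ ?_)
      · exact Primrec.eq.comp (Primrec.snd.comp Primrec.snd)
          (Primrec.snd.comp (Primrec.fst.comp Primrec.fst))
      · exact Primrec.option_some.comp (Primrec.pair
          (Primrec.fst.comp (Primrec.fst.comp Primrec.fst)) (Primrec.fst.comp Primrec.snd))
      · exact Primrec.const none
    exact this.to_comp.comp (Computable.pair Computable.id (hP.comp Computable.fst))
  obtain ⟨c, hc⟩ := hU.exists_le_of_mem_list hT
  refine ⟨c, fun B x => ?_⟩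
  have h := (hc (sortedList ν B, letters ν (τ x) (sortedList ν B))
    (sortedList ν B, letters ν x (sortedList ν B)) (by
      rw [List.mem_filterMap]
      exact ⟨_, (hPmem _ _ _).2 ⟨x, rfl, rfl⟩, by simp⟩)).1
  refine h.trans ?_
  gcongr
  · exact le_rfl
  · refine card_toFinset_le_ncard ν B _ _ fun p hp => ?_
    obtain ⟨⟨c', d⟩, hcd, hp⟩ := List.mem_filterMap.1 hp
    obtain ⟨z, rfl, rfl⟩ := (hPmem _ _ _).1 hcd
    simp only [Option.ite_none_right_eq_some, Option.some.injEq] at hp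
    exact ⟨z, ⟨z, letters_sortedList_eq_iff.1 hp.1, rfl⟩, hp.2.symm⟩

/-- `τ(x)|_B` is described by `B` and its index among the words of the image of `τ`. -/
theorem exists_wordComplexity_image_le_clog (hG : IsComputableGroup G ν)
    (hU : IsOptimalDecompressor U) (hτ : IsCellularAutomaton τ) :
    ∃ c, ∀ (B : Finset G) (x : G → A),
      wordComplexity U ν (τ x) B ≤ 2 * setComplexity U ν B + Nat.clog 2
        ((B.restrict (π := fun _ => A)) '' (τ '' Set.univ)).ncard + c := by
  obtain ⟨P, hP, hPmem⟩ := hτ.exists_computable_pairs hG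
  have hT : Computable fun l : List ℕ => (P l).map fun p => (l, p.2) := by
    have : Primrec fun x : List ℕ × List (List ℕ × List ℕ) => x.2.map fun p => (x.1, p.2) :=
      Primrec.list_map Primrec.snd (Primrec.pair (Primrec.fst.comp Primrec.fst)
        (Primrec.snd.comp Primrec.snd)).to₂
    exact this.to_comp.comp (Computable.pair Computable.id hP)
  obtain ⟨c, hc⟩ := hU.exists_le_of_mem_list hT
  refine ⟨c, fun B x => ?_⟩
  -- The second bound is used: here the index is the main term, and the doubled complexity of `B` is
  -- negligible by modesty.
  have h := (hc (sortedList ν B) (sortedList ν B, letters ν (τ x) (sortedList ν B)) (by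
      rw [List.mem_map]
      exact ⟨_, (hPmem _ _ _).2 ⟨x, rfl, rfl⟩, rfl⟩)).2
  refine h.trans ?_
  gcongr
  · exact le_rfl
  · refine card_toFinset_le_ncard ν B _ _ fun p hp => ?_
    obtain ⟨⟨c', d⟩, hcd, rfl⟩ := List.mem_map.1 hp
    obtain ⟨z, rfl, rfl⟩ := (hPmem _ _ _).1 hcd
    exact ⟨τ z, ⟨τ z, ⟨z, trivial, rfl⟩, rfl⟩, rfl⟩

end Counting

/-! ### Boundaries -/

section Boundary

variable {G A : Type*} [Group G]

theorem mem_map_mulRight {B : Finset G} {s g : G} :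
    g ∈ B.map (mulRightEmbedding s) ↔ g * s⁻¹ ∈ B := by
  rw [Finset.mem_map]
  constructor
  · rintro ⟨b, hb, rfl⟩
    simpa using hb
  · exact fun h => ⟨_, h, by simp⟩

variable {τ : (G → A) → (G → A)} {S : Finset G} {μ : (S → A) → A}

/-- The values of `τ` at `g` depend only on the values on `g S`. -/
theorem apply_eq_of_eqOn (hτ : ∀ (x : G → A) (g : G), τ x g = μ (S.restrict (shift g⁻¹ x)))
    {x y : G → A} {g : G} (h : ∀ s ∈ S, x (g * s) = y (g * s)) : τ x g = τ y g := by
  rw [hτ, hτ]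
  congr 1
  funext s
  simpa [shift] using h s s.2

variable [DecidableEq G]

/-- The `S`-boundary of `B`: the points where `B s` and `B` differ for some `s ∈ S`. -/
def boundary (S B : Finset G) : Finset G :=
  S.biUnion fun s => symmDiff (B.map (mulRightEmbedding s)) B

theorem mul_mem_boundary {S B : Finset G} {g s : G} (hs : s ∈ S) (hg : g ∈ B) (hgs : g * s ∉ B) :
    g * s ∈ boundary S B := by
  refine Finset.mem_biUnion.2 ⟨s, hs, Finset.mem_symmDiff.2 (Or.inl ⟨mem_map_mulRight.2 ?_, hgs⟩)⟩
  simpa using hg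

theorem mul_mem_boundary' {S B : Finset G} {g s : G} (hs : s ∈ S) (hg : g ∉ B) (hgs : g * s ∈ B) :
    g * s ∈ boundary S B := by
  refine Finset.mem_biUnion.2 ⟨s, hs, Finset.mem_symmDiff.2 (Or.inr ⟨hgs, fun h => hg ?_⟩)⟩
  simpa using mem_map_mulRight.1 h

theorem card_boundary_le (S B : Finset G) :
    (boundary S B).card ≤ ∑ s ∈ S, (symmDiff (B.map (mulRightEmbedding s)) B).card :=
  Finset.card_biUnion_le

theorem IsFolnerSequence.tendsto_boundary {F : ℕ → Finset G} (hF : IsFolnerSequence F)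
    (S : Finset G) :
    Tendsto (fun n => ((boundary S (F n)).card : ℝ) / (F n).card) atTop (𝓝 0) := by
  have h := tendsto_finsetSum S fun s _ => hF.2 s
  rw [Finset.sum_const_zero] at h
  refine squeeze_zero (fun n => by positivity) (fun n => ?_) h
  rw [← Finset.sum_div]
  gcongr
  exact_mod_cast card_boundary_le S (F n)

theorem IsFolnerSequence.tendsto_card {F : ℕ → Finset G} [Infinite G] (hF : IsFolnerSequence F) :
    Tendsto (fun n => (F n).card) atTop atTop := by
  refine tendsto_atTop.2 fun M => ?_
  obtain ⟨K, hK⟩ := Infinite.exists_subset_card_eq G M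
  have h := (hF.tendsto_boundary (K.map (Equiv.inv G).toEmbedding)).eventually
    (gt_mem_nhds one_pos)
  filter_upwards [h] with n hn
  have hpos : (0 : ℝ) < (F n).card := by exact_mod_cast (hF.1 n).card_pos
  rw [div_lt_one hpos, Nat.cast_lt] at hn
  -- A point `f` of `F n` off the boundary for `K⁻¹` satisfies `f K ⊆ F n`, so `F n` has at least
  -- `|K|` elements.
  obtain ⟨f, hf, hf'⟩ := Finset.exists_mem_notMem_of_card_lt_card hn
  rw [← hK, ← Finset.card_map (mulLeftEmbedding f)]
  refine Finset.card_le_card fun g hg => ?_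
  obtain ⟨k, hk, rfl⟩ := Finset.mem_map.1 hg
  by_contra hfk
  refine hf' ?_
  have := mul_mem_boundary' (S := K.map (Equiv.inv G).toEmbedding) (B := F n) (g := f * k)
    (s := k⁻¹) (by simpa using hk) hfk (by simpa using hf)
  simpa using this

theorem IsFolnerSequence.tendsto_const_div {F : ℕ → Finset G} [Infinite G]
    (hF : IsFolnerSequence F) (c : ℝ) : Tendsto (fun n => c / (F n).card) atTop (𝓝 0) :=
  tendsto_const_nhds.div_atTop (tendsto_natCast_atTop_atTop.comp hF.tendsto_card)

theorem image_restrict_eq (hτ : ∀ (x : G → A) (g : G), τ x g = μ (S.restrict (shift g⁻¹ x)))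
    {B : Finset G} {x y : G → A} (hB : B.restrict (π := fun _ => A) x = B.restrict y)
    (hE : (boundary S B).restrict (π := fun _ => A) x = (boundary S B).restrict y) :
    B.restrict (π := fun _ => A) (τ x) = B.restrict (τ y) := by
  funext g
  refine apply_eq_of_eqOn hτ fun s hs => ?_
  by_cases hgs : (g : G) * s ∈ B
  · exact congrFun hB ⟨_, hgs⟩
  · exact congrFun hE ⟨_, mul_mem_boundary hs g.2 hgs⟩

theorem IsPreInjective.restrict_eq (hpre : IsPreInjective τ)
    (hτ : ∀ (x : G → A) (g : G), τ x g = μ (S.restrict (shift g⁻¹ x)))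
    {B : Finset G} {x y : G → A}
    (hB : B.restrict (π := fun _ => A) (τ x) = B.restrict (τ y))
    (hE : (boundary S B).restrict (π := fun _ => A) x = (boundary S B).restrict y) :
    B.restrict (π := fun _ => A) x = B.restrict y := by
  have hE' : ∀ g ∈ boundary S B, x g = y g := fun g hg => congrFun hE ⟨g, hg⟩
  -- Splice `x` inside `B` with `y` outside. Agreement on both the inner and the outer part of the
  -- boundary makes every window of `w` look like a window of `x` (centre in `B`) or of `y` (centre
  -- outside), so `τ w = τ y` and pre-injectivity applies.
  let w : G → A := fun g => if g ∈ B then x g else y g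
  have hw : τ w = τ y := by
    funext g
    by_cases hg : g ∈ B
    · refine (apply_eq_of_eqOn hτ fun s hs => ?_).trans (congrFun hB ⟨g, hg⟩)
      by_cases hgs : g * s ∈ B
      · simp [w, hgs]
      · simp [w, hgs, hE' _ (mul_mem_boundary hs hg hgs)]
    · refine apply_eq_of_eqOn hτ fun s hs => ?_
      by_cases hgs : g * s ∈ B
      · simp [w, hgs, hE' _ (mul_mem_boundary' hs hg hgs)]
      · simp [w, hgs]
  have := hpre w y ⟨B, fun g hg => by simp [w, hg]⟩ hw
  funext g
  simpa [w] using congrFun this g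

variable [Finite A]

theorem ncard_image_words_le (hτ : ∀ (x : G → A) (g : G), τ x g = μ (S.restrict (shift g⁻¹ x)))
    (B : Finset G) (x : G → A) :
    ((fun z => B.restrict (π := fun _ => A) (τ z)) ''
      {z | B.restrict (π := fun _ => A) z = B.restrict x}).ncard ≤
      Nat.card A ^ (boundary S B).card :=
  (ncard_image_le_of_determines _ (fun z => (boundary S B).restrict (π := fun _ => A) z)
    (Set.toFinite _) fun _ hz _ hz' h => image_restrict_eq hτ (hz.trans hz'.symm) h).trans
    (ncard_restrict_image_le _ _)

theorem IsPreInjective.ncard_words_le (hpre : IsPreInjective τ)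
    (hτ : ∀ (x : G → A) (g : G), τ x g = μ (S.restrict (shift g⁻¹ x)))
    (B : Finset G) (x : G → A) :
    ((fun z => B.restrict (π := fun _ => A) z) ''
      {z | B.restrict (π := fun _ => A) (τ z) = B.restrict (τ x)}).ncard ≤
      Nat.card A ^ (boundary S B).card :=
  (ncard_image_le_of_determines _ (fun z => (boundary S B).restrict (π := fun _ => A) z)
    (Set.toFinite _) fun _ hz _ hz' h => hpre.restrict_eq hτ (hz.trans hz'.symm) h).trans
    (ncard_restrict_image_le _ _)

theorem IsPreInjective.card_pow_le [Nonempty A] (hpre : IsPreInjective τ)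
    (hτ : ∀ (x : G → A) (g : G), τ x g = μ (S.restrict (shift g⁻¹ x))) (B : Finset G) :
    Nat.card A ^ B.card ≤ ((B.restrict (π := fun _ => A)) '' (τ '' Set.univ)).ncard *
      Nat.card A ^ (boundary S B).card := by
  rw [← ncard_restrict_image_univ B, Set.image_image]
  refine (ncard_image_le_of_determines _ (fun z => (B.restrict (π := fun _ => A) (τ z),
    (boundary S B).restrict (π := fun _ => A) z)) (Set.toFinite _) fun z _ z' _ h => ?_).trans
    (ncard_pair_image_le _ _ _ _ _)
  exact hpre.restrict_eq hτ (congrArg Prod.fst h) (congrArg Prod.snd h)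

theorem ncard_restrict_image_image_le
    (hτ : ∀ (x : G → A) (g : G), τ x g = μ (S.restrict (shift g⁻¹ x))) (B : Finset G)
    (X : Set (G → A)) :
    ((B.restrict (π := fun _ => A)) '' (τ '' X)).ncard ≤
      ((B.restrict (π := fun _ => A)) '' X).ncard * Nat.card A ^ (boundary S B).card := by
  rw [Set.image_image]
  refine (ncard_image_le_of_determines _ (fun z => (B.restrict (π := fun _ => A) z,
    (boundary S B).restrict (π := fun _ => A) z)) (Set.toFinite _) fun z _ z' _ h => ?_).trans
    (ncard_pair_image_le _ _ _ _ _)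
  exact image_restrict_eq hτ (congrArg Prod.fst h) (congrArg Prod.snd h)

end Boundary

/-! ### Words avoiding a pattern on disjoint tiles -/

section Tiles

variable {G A : Type*} [Group G]

/-- The translates `g D`, `g ∈ T`, are pairwise disjoint. -/
def TilesDisjoint (D T : Finset G) : Prop :=
  ∀ g ∈ T, ∀ h ∈ T, ∀ d ∈ D, ∀ d' ∈ D, g * d = h * d' → g = h

theorem TilesDisjoint.mono {D T T' : Finset G} (h : TilesDisjoint D T') (hT : T ⊆ T') :
    TilesDisjoint D T :=
  fun g hg g' hg' => h g (hT hg) g' (hT hg')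

/-- The configurations that do not show the pattern `p|_D` at any of the places in `T`. -/
def avoiding (D : Finset G) (p : G → A) (T : Finset G) : Set (G → A) :=
  {x | ∀ g ∈ T, ∃ d ∈ D, x (g * d) ≠ p d}

variable [DecidableEq G]

/-- The places `g ∈ B` with `g D ⊆ B`. -/
def interiorOf (D B : Finset G) : Finset G := B.filter fun g => ∀ d ∈ D, g * d ∈ B

theorem card_le_interiorOf (D B : Finset G) :
    B.card ≤ (interiorOf D B).card + (boundary D B).card * D.card := by
  have hsub : B ⊆ interiorOf D B ∪ (boundary D B ×ˢ D).image fun x => x.1 * x.2⁻¹ := by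
    intro g hg
    by_cases h : ∀ d ∈ D, g * d ∈ B
    · exact Finset.mem_union_left _ (Finset.mem_filter.2 ⟨hg, h⟩)
    · push Not at h
      obtain ⟨d, hd, hgd⟩ := h
      exact Finset.mem_union_right _ (Finset.mem_image.2
        ⟨(g * d, d), Finset.mem_product.2 ⟨mul_mem_boundary hd hg hgd, hd⟩, by simp⟩)
  refine (Finset.card_le_card hsub).trans ((Finset.card_union_le _ _).trans ?_)
  gcongr
  exact Finset.card_image_le.trans (Finset.card_product _ _).le

/-- For a maximal disjoint family, each `g D` with `g ∈ I` meets some tile `t D`, so `I ⊆ T D D⁻¹`.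
-/
theorem exists_tilesDisjoint {D : Finset G} (hD : D.Nonempty) (I : Finset G) :
    ∃ T ⊆ I, TilesDisjoint D T ∧ I.card ≤ T.card * D.card ^ 2 := by
  classical
  obtain ⟨T, hT, hmax⟩ := Finset.exists_max_image (I.powerset.filter fun T => TilesDisjoint D T)
    Finset.card ⟨∅, Finset.mem_filter.2 ⟨Finset.empty_mem_powerset I, by simp [TilesDisjoint]⟩⟩
  obtain ⟨hTI, hTD⟩ := Finset.mem_filter.1 hT
  rw [Finset.mem_powerset] at hTI
  refine ⟨T, hTI, hTD, ?_⟩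
  have hsub : I ⊆ (T ×ˢ (D ×ˢ D)).image fun x => x.1 * x.2.1 * x.2.2⁻¹ := by
    intro g hg
    suffices ∃ t ∈ T, ∃ d' ∈ D, ∃ d ∈ D, g * d' = t * d by
      obtain ⟨t, ht, d', hd', d, hd, h⟩ := this
      exact Finset.mem_image.2 ⟨(t, d, d'), by simp [ht, hd, hd'], by simp [← h]⟩
    by_contra! hcon
    obtain ⟨d₀, hd₀⟩ := hD
    have hgT : g ∉ T := fun h => hcon g h d₀ hd₀ d₀ hd₀ rfl
    have hins : TilesDisjoint D (insert g T) := by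
      intro h hh h' hh' d hd d' hd' heq
      rcases Finset.mem_insert.1 hh with rfl | hT1 <;>
        rcases Finset.mem_insert.1 hh' with rfl | hT2
      · rfl
      · exact absurd heq (hcon h' hT2 d hd d' hd')
      · exact absurd heq.symm (hcon h hT1 d' hd' d hd)
      · exact hTD h hT1 h' hT2 d hd d' hd' heq
    have := hmax (insert g T) (Finset.mem_filter.2
      ⟨Finset.mem_powerset.2 (Finset.insert_subset hg hTI), hins⟩)
    rw [Finset.card_insert_of_notMem hgT] at this
    omega
  refine (Finset.card_le_card hsub).trans (Finset.card_image_le.trans ?_)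
  rw [Finset.card_product, Finset.card_product, sq]

/-- The words on `B` that do not show the pattern `p|_D` at any of the places in `T`. -/
def avoidingWords (D : Finset G) (p : G → A) (T B : Finset G) : Set (B → A) :=
  {w | ∀ g ∈ T, ∃ d ∈ D, ∃ h : g * d ∈ B, w ⟨g * d, h⟩ ≠ p d}

theorem restrict_image_avoiding_subset {D T B : Finset G} (hT : T ⊆ interiorOf D B) (p : G → A) :
    (B.restrict (π := fun _ => A)) '' avoiding D p T ⊆ avoidingWords D p T B := by
  rintro _ ⟨x, hx, rfl⟩ g hg
  obtain ⟨d, hd, hne⟩ := hx g hg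
  exact ⟨d, hd, (Finset.mem_filter.1 (hT hg)).2 d hd, hne⟩

variable [Finite A]

/-- Writing `p` over the tile `g D` sends a word avoiding `p` on `T` to one that still does, by
disjointness, but shows `p` at `g`. Only the `|D|` overwritten letters are lost, so this map is at
most `|A|^|D|`-to-one. -/
theorem ncard_avoidingWords_insert_le {D T B : Finset G} {g : G}
    (hT : insert g T ⊆ interiorOf D B) (hTD : TilesDisjoint D (insert g T)) (hg : g ∉ T)
    (p : G → A) :
    (avoidingWords D p T B).ncard ≤
      ((avoidingWords D p T B).ncard - (avoidingWords D p (insert g T) B).ncard) *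
        Nat.card A ^ D.card := by
  have hgB : ∀ d ∈ D, g * d ∈ B :=
    (Finset.mem_filter.1 (hT (Finset.mem_insert_self g T))).2
  have hsub : avoidingWords D p (insert g T) B ⊆ avoidingWords D p T B :=
    fun w hw h hh => hw h (Finset.mem_insert_of_mem hh)
  rw [← Set.ncard_sdiff hsub]
  let swap : (B → A) → B → A := fun w b => if g⁻¹ * b ∈ D then p (g⁻¹ * b) else w b
  have h1 : (avoidingWords D p T B).ncard ≤ (swap '' avoidingWords D p T B).ncard *
      Nat.card A ^ D.card := by
    have h := ncard_image_le_of_determines (Z := avoidingWords D p T B) id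
      (fun w => (swap w, fun d : D => w ⟨g * d, hgB d d.2⟩)) (Set.toFinite _)
      (fun w _ w' _ h => by
        funext b
        by_cases hb : g⁻¹ * b ∈ D
        · simpa using congrFun (congrArg Prod.snd h) ⟨g⁻¹ * b, hb⟩
        · simpa [swap, hb] using congrFun (congrArg Prod.fst h) b)
    rw [Set.image_id] at h
    exact h.trans (ncard_pair_image_le _ _ _ _ _)
  refine h1.trans (Nat.mul_le_mul_right _ (Set.ncard_le_ncard ?_))
  rintro _ ⟨w, hw, rfl⟩
  refine ⟨fun t ht => ?_, fun hcon => ?_⟩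
  · obtain ⟨d, hd, hB, hne⟩ := hw t ht
    refine ⟨d, hd, hB, ?_⟩
    have hnot : g⁻¹ * (t * d) ∉ D := fun hmem => hg <| by
      have := hTD g (Finset.mem_insert_self g T) t (Finset.mem_insert_of_mem ht) _ hmem d hd
        (by group)
      exact this ▸ ht
    simpa [swap, hnot] using hne
  · obtain ⟨d, hd, hB, hne⟩ := hcon g (Finset.mem_insert_self g T)
    simp [swap, hd] at hne

theorem ncard_avoidingWords_le [Nonempty A] {D T B : Finset G} (hT : T ⊆ interiorOf D B)
    (hTD : TilesDisjoint D T) (p : G → A) :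
    ((avoidingWords D p T B).ncard : ℝ) ≤
      (Nat.card A : ℝ) ^ B.card * (1 - 1 / (Nat.card A : ℝ) ^ D.card) ^ T.card := by
  have hk : (1 : ℝ) ≤ Nat.card A := by exact_mod_cast Nat.card_pos
  have hK : (1 : ℝ) ≤ (Nat.card A : ℝ) ^ D.card := one_le_pow₀ hk
  induction T using Finset.induction_on with
  | empty =>
    rw [Finset.card_empty, pow_zero, mul_one]
    exact_mod_cast ncard_restrict_image_le B _
  | insert g T hg ih =>
    have ih := ih ((Finset.subset_insert g T).trans hT) (hTD.mono (Finset.subset_insert g T))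
    have hstep := ncard_avoidingWords_insert_le hT hTD hg p
    have hle : (avoidingWords D p (insert g T) B).ncard ≤ (avoidingWords D p T B).ncard :=
      Set.ncard_le_ncard fun w hw h hh => hw h (Finset.mem_insert_of_mem hh)
    have hstep' : ((avoidingWords D p T B).ncard : ℝ) ≤
        ((avoidingWords D p T B).ncard - (avoidingWords D p (insert g T) B).ncard) *
          (Nat.card A : ℝ) ^ D.card := by
      rw [← Nat.cast_sub hle]
      exact_mod_cast hstep
    rw [Finset.card_insert_of_notMem hg, pow_succ, ← mul_assoc]
    have h0 : 0 ≤ 1 - 1 / (Nat.card A : ℝ) ^ D.card := by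
      rw [sub_nonneg, div_le_one (by linarith)]
      exact hK
    refine le_trans ?_ (mul_le_mul_of_nonneg_right ih h0)
    rw [← div_le_iff₀ (by linarith)] at hstep'
    rw [mul_sub, mul_one, mul_one_div]
    linarith

end Tiles

/-! ### Images of patterns -/

section Patterns

variable {G A : Type*} [Group G]

variable {τ : (G → A) → (G → A)} {S : Finset G} {μ : (S → A) → A}

theorem apply_shift (hτ : ∀ (x : G → A) (g : G), τ x g = μ (S.restrict (shift g⁻¹ x)))
    (x : G → A) (g h : G) : τ (shift g x) h = τ x (g⁻¹ * h) := by
  rw [hτ, hτ]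
  congr 1
  funext s
  simp [shift, mul_assoc]

/-- If `x` has no preimage, then some finite pattern of `x` has no preimage. -/
theorem exists_pattern_of_notMem_range [Finite A]
    (hτ : ∀ (x : G → A) (g : G), τ x g = μ (S.restrict (shift g⁻¹ x)))
    {x : G → A} (hx : x ∉ Set.range τ) : ∃ D : Finset G, ∀ y, ∃ d ∈ D, τ y d ≠ x d := by
  -- With `A` discrete, `A^G` is compact and `τ` continuous, so the range is closed; a cylinder
  -- around `x` avoids it.
  let : TopologicalSpace A := ⊥
  have : DiscreteTopology A := ⟨rfl⟩
  have hcont : Continuous τ := by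
    refine continuous_pi fun g => ?_
    have : (fun y => τ y g) = μ ∘ fun y => S.restrict (shift g⁻¹ y) := funext fun y => hτ y g
    rw [this]
    refine continuous_of_discreteTopology.comp (continuous_pi fun s => ?_)
    exact continuous_apply _
  have hopen : IsOpen (Set.range τ)ᶜ := (isCompact_range hcont).isClosed.isOpen_compl
  obtain ⟨D, u, hu, hsub⟩ := isOpen_pi_iff.1 hopen x hx
  refine ⟨D, fun y => ?_⟩
  by_contra! hcon
  exact hsub (fun d hd => by rw [hcon d hd]; exact (hu d hd).2) ⟨y, rfl⟩

end Patterns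

/-! ### Entropy -/

section Entropy

theorem limsup_coe_le_of_le_add {u v ε : ℕ → ℝ} (h : ∀ n, u n ≤ v n + ε n)
    (hε : Tendsto ε atTop (𝓝 0)) :
    limsup (fun n => (u n : EReal)) atTop ≤ limsup (fun n => (v n : EReal)) atTop := by
  have h0 : limsup (fun n => (ε n : EReal)) atTop = 0 :=
    ((continuous_coe_real_ereal.tendsto 0).comp hε).limsup_eq
  calc limsup (fun n => (u n : EReal)) atTop
      ≤ limsup ((fun n => (v n : EReal)) + fun n => (ε n : EReal)) atTop :=
        limsup_le_limsup (Eventually.of_forall fun n => by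
          simpa using EReal.coe_le_coe_iff.2 (h n))
    _ ≤ _ := EReal.limsup_add_le (Or.inr (by simp [h0])) (Or.inr (by simp [h0]))
    _ = _ := by rw [h0, add_zero]

variable {G A : Type*} {F : ℕ → Finset G}

theorem limsup_coe_le {u v : ℕ → ℝ} {a : ℝ} (h : ∀ n, u n ≤ v n)
    (hv : Tendsto v atTop (𝓝 a)) : limsup (fun n => (u n : EReal)) atTop ≤ a := by
  rw [← ((continuous_coe_real_ereal.tendsto a).comp hv).limsup_eq]
  exact limsup_le_limsup (Eventually.of_forall fun n => EReal.coe_le_coe_iff.2 (h n))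

theorem entropy_univ [Finite A] [Nonempty A] (hF : ∀ n, (F n).Nonempty) :
    entropy F (Set.univ : Set (G → A)) = (Real.logb 2 (Nat.card A) : ℝ) := by
  have (n : ℕ) : Real.logb 2 (((F n).restrict (π := fun _ => A)) '' Set.univ).ncard /
      (F n).card = Real.logb 2 (Nat.card A) := by
    have : ((F n).card : ℝ) ≠ 0 := by exact_mod_cast (hF n).card_ne_zero
    rw [ncard_restrict_image_univ, Nat.cast_pow, Real.logb_pow, mul_div_cancel_left₀ _ this]
  simp only [entropy, this, limsup_const]

theorem entropy_mono [Finite A] {X Y : Set (G → A)} (hX : X.Nonempty) (h : X ⊆ Y) :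
    entropy F X ≤ entropy F Y := by
  refine limsup_le_limsup (Eventually.of_forall fun n => EReal.coe_le_coe_iff.2 ?_)
  have hpos : 0 < (((F n).restrict (π := fun _ => A)) '' X).ncard :=
    (Set.ncard_pos (Set.toFinite _)).2 (hX.image _)
  gcongr
  · norm_num
  · exact Set.toFinite _

variable [Group G] [DecidableEq G]

/-- A set of configurations whose words are determined, up to boundary terms, by words avoiding a
fixed pattern on arbitrary families of disjoint tiles has less than full entropy. -/
theorem IsFolnerSequence.entropy_lt [Finite A] [Nonempty A] (hF : IsFolnerSequence F)
    {D S : Finset G} (hD : D.Nonempty) (p : G → A) {X : Set (G → A)} (hX : X.Nonempty)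
    (h : ∀ T B : Finset G, TilesDisjoint D T → ((B.restrict (π := fun _ => A)) '' X).ncard ≤
      ((B.restrict (π := fun _ => A)) '' avoiding D p T).ncard *
        Nat.card A ^ (boundary S B).card) :
    entropy F X < entropy F (Set.univ : Set (G → A)) := by
  have hk : (1 : ℝ) ≤ Nat.card A := by exact_mod_cast Nat.card_pos
  have hK : (1 : ℝ) ≤ (Nat.card A : ℝ) ^ D.card := one_le_pow₀ hk
  set K : ℝ := (Nat.card A : ℝ) ^ D.card with hKdef
  set κ : ℝ := Real.logb 2 (Nat.card A) with hκ
  have hκ0 : 0 ≤ κ := Real.logb_nonneg (by norm_num) hk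
  -- The factor `1 - 1 / K` vanishes when `|A| = 1`; halving the loss keeps `δ` positive, so that
  -- its logarithm can be used.
  set δ : ℝ := 1 - 1 / (2 * K) with hδ
  have hδ0 : 0 < δ := by
    have : 1 / (2 * K) < 1 := by rw [div_lt_one (by linarith)]; linarith
    linarith
  have hδ1 : δ < 1 := by
    have : 0 < 1 / (2 * K) := by positivity
    linarith
  set l : ℝ := -Real.logb 2 δ with hl
  have hl0 : 0 < l := neg_pos.2 (Real.logb_neg (by norm_num) hδ0 hδ1)
  have hd0 : (0 : ℝ) < D.card := by exact_mod_cast hD.card_pos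
  -- This comes from `κ|B| - l|T| + κ|∂_S B|` after inserting `|T| ≥ (|B| - |∂_D B| |D|) / |D|²` and
  -- dividing by `|B|`.
  let v : ℕ → ℝ := fun n => κ - l / (D.card : ℝ) ^ 2 +
    l / D.card * ((boundary D (F n)).card / (F n).card) +
      κ * ((boundary S (F n)).card / (F n).card)
  have hv : Tendsto v atTop (𝓝 (κ - l / (D.card : ℝ) ^ 2)) := by
    simpa using ((tendsto_const_nhds (x := κ - l / (D.card : ℝ) ^ 2)).add
      ((hF.tendsto_boundary D).const_mul (l / D.card))).add ((hF.tendsto_boundary S).const_mul κ)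
  have hlt : κ - l / (D.card : ℝ) ^ 2 < κ := by
    have : 0 < l / (D.card : ℝ) ^ 2 := by positivity
    linarith
  rw [entropy_univ hF.1]
  refine (limsup_coe_le (fun n => ?_) hv).trans_lt (EReal.coe_lt_coe_iff.2 hlt)
  have hn : (0 : ℝ) < (F n).card := by exact_mod_cast (hF.1 n).card_pos
  set B := F n with hB
  obtain ⟨T, hTI, hTD, hTcard⟩ := exists_tilesDisjoint hD (interiorOf D B)
  have hint := card_le_interiorOf D B
  have hT : (B.card : ℝ) - (boundary D B).card * D.card ≤ T.card * (D.card : ℝ) ^ 2 := by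
    rw [sub_le_iff_le_add]
    exact_mod_cast hint.trans (Nat.add_le_add_right hTcard _)
  have hN : ((((B.restrict (π := fun _ => A)) '' X).ncard : ℕ) : ℝ) ≤
      (Nat.card A : ℝ) ^ B.card * δ ^ T.card * (Nat.card A : ℝ) ^ (boundary S B).card := by
    have h1 : ((((B.restrict (π := fun _ => A)) '' X).ncard : ℕ) : ℝ) ≤
        ((B.restrict (π := fun _ => A)) '' avoiding D p T).ncard *
          (Nat.card A : ℝ) ^ (boundary S B).card := by exact_mod_cast h T B hTD
    refine h1.trans (mul_le_mul_of_nonneg_right ?_ (by positivity))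
    have h2 : ((((B.restrict (π := fun _ => A)) '' avoiding D p T).ncard : ℕ) : ℝ) ≤
        (avoidingWords D p T B).ncard := by
      exact_mod_cast Set.ncard_le_ncard (restrict_image_avoiding_subset hTI p)
    refine h2.trans ((ncard_avoidingWords_le hTI hTD p).trans ?_)
    have h3 : 0 ≤ 1 - 1 / K := by
      rw [sub_nonneg, div_le_one (by linarith)]
      exact hK
    have h4 : 1 - 1 / K ≤ δ := by
      rw [hδ]
      gcongr
      linarith
    gcongr
  have hpos : (0 : ℝ) < ((B.restrict (π := fun _ => A)) '' X).ncard := by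
    exact_mod_cast (Set.ncard_pos (Set.toFinite _)).2 (hX.image _)
  have hk0 : (0 : ℝ) < Nat.card A := by linarith
  have hlog : Real.logb 2 ((B.restrict (π := fun _ => A)) '' X).ncard ≤
      B.card * κ - T.card * l + (boundary S B).card * κ := by
    refine (Real.logb_le_logb_of_le (by norm_num) hpos hN).trans_eq ?_
    rw [Real.logb_mul (by positivity) (by positivity), Real.logb_mul (by positivity)
      (by positivity), Real.logb_pow, Real.logb_pow, Real.logb_pow, hl]
    ring
  rw [div_le_iff₀ hn]
  refine hlog.trans ?_
  have hTl : l * ((B.card : ℝ) - (boundary D B).card * D.card) / (D.card : ℝ) ^ 2 ≤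
      T.card * l := by
    rw [div_le_iff₀ (by positivity)]
    nlinarith
  have hexp : v n * B.card = B.card * κ -
      l * ((B.card : ℝ) - (boundary D B).card * D.card) / (D.card : ℝ) ^ 2 +
        (boundary S B).card * κ := by
    simp only [v, ← hB]
    field_simp
    ring
  rw [hexp]
  linarith

variable {τ : (G → A) → (G → A)} {S : Finset G} {μ : (S → A) → A}

theorem IsFolnerSequence.surjective_of_entropy_eq [Finite A] [Nonempty A]
    (hF : IsFolnerSequence F)
    (hτ : ∀ (x : G → A) (g : G), τ x g = μ (S.restrict (shift g⁻¹ x)))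
    (h : entropy F (τ '' Set.univ) = entropy F (Set.univ : Set (G → A))) :
    Function.Surjective τ := by
  intro x
  by_contra hx
  obtain ⟨D, hD⟩ := exists_pattern_of_notMem_range hτ hx
  have hne : D.Nonempty := by
    obtain ⟨d, hd, -⟩ := hD x
    exact ⟨d, hd⟩
  refine (hF.entropy_lt (S := S) hne x (Set.univ_nonempty.image τ) fun T B _ => ?_).ne h
  refine le_trans (Set.ncard_le_ncard (Set.image_mono ?_))
    (Nat.le_mul_of_pos_right _ (pow_pos Nat.card_pos _))
  rintro _ ⟨y, -, rfl⟩ g -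
  obtain ⟨d, hd, hne⟩ := hD (shift g⁻¹ y)
  refine ⟨d, hd, ?_⟩
  rwa [apply_shift hτ, inv_inv] at hne

/-- Occurrences of `z|_D` on the tiles are replaced by `z'|_D` one at a time. The set `D` contains
every window that meets `E`, so no replacement changes the image. -/
theorem exists_avoiding_apply_eq
    (hτ : ∀ (x : G → A) (g : G), τ x g = μ (S.restrict (shift g⁻¹ x)))
    {z z' : G → A} (hzz' : τ z = τ z') {E D : Finset G} (hE : ∀ g, g ∉ E → z g = z' g)
    (hne : z ≠ z') (hED : E ⊆ D) (hD : ∀ g, ∀ s ∈ S, g * s ∈ E → ∀ s' ∈ S, g * s' ∈ D)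
    {T : Finset G} (hT : TilesDisjoint D T) (x : G → A) : ∃ y ∈ avoiding D z T, τ y = τ x := by
  induction T using Finset.induction_on with
  | empty => exact ⟨x, by simp [avoiding], rfl⟩
  | insert g T hg ih =>
    obtain ⟨y, hy, hyx⟩ := ih (hT.mono (Finset.subset_insert g T))
    by_cases hocc : ∃ d ∈ D, y (g * d) ≠ z d
    · refine ⟨y, fun t ht => ?_, hyx⟩
      rcases Finset.mem_insert.1 ht with rfl | ht
      · exact hocc
      · exact hy t ht
    push Not at hocc
    let w : G → A := fun h => if g⁻¹ * h ∈ D then z' (g⁻¹ * h) else y h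
    refine ⟨w, fun t ht => ?_, ?_⟩
    · rcases Finset.mem_insert.1 ht with rfl | ht
      · obtain ⟨d, hd⟩ := Function.ne_iff.1 hne
        have hdD : d ∈ D := hED (by_contra fun h => hd (hE d h))
        exact ⟨d, hdD, by simpa [w, hdD] using hd.symm⟩
      · obtain ⟨d, hd, hyd⟩ := hy t ht
        have hnot : g⁻¹ * (t * d) ∉ D := fun hmem => hg <| by
          have := hT g (Finset.mem_insert_self g T) t (Finset.mem_insert_of_mem ht) _ hmem d hd
            (by group)
          exact this ▸ ht
        exact ⟨d, hd, by simpa [w, hnot] using hyd⟩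
    · rw [← hyx]
      funext h
      -- If the window meets the translate of `E`, it lies inside the tile, where `w` and `y` are
      -- translates of `z'` and `z`. Otherwise `w` and `y` agree on it, since `z = z'` off `E`.
      by_cases hmeet : ∃ s ∈ S, g⁻¹ * h * s ∈ E
      · obtain ⟨s, hs, hsE⟩ := hmeet
        have hin := hD _ s hs hsE
        have h1 : τ w h = τ (shift g z') h := apply_eq_of_eqOn hτ fun s' hs' => by
          simp [w, shift, ← mul_assoc, hin s' hs']
        have h2 : τ y h = τ (shift g z) h := apply_eq_of_eqOn hτ fun s' hs' => by
          have := hocc _ (hin s' hs')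
          simpa [shift, mul_assoc] using this
        rw [h1, h2, apply_shift hτ, apply_shift hτ, hzz']
      · push Not at hmeet
        refine apply_eq_of_eqOn hτ fun s hs => ?_
        by_cases hmem : g⁻¹ * (h * s) ∈ D
        · have h1 := hE _ (hmeet s hs)
          have h2 := hocc _ hmem
          rw [mul_assoc] at h1
          simp only [mul_inv_cancel_left] at h2
          simp only [w, hmem, if_true, h2, h1]
        · simp [w, hmem]

theorem IsFolnerSequence.isPreInjective_of_entropy_eq [Finite A] [Nonempty A]
    (hF : IsFolnerSequence F)
    (hτ : ∀ (x : G → A) (g : G), τ x g = μ (S.restrict (shift g⁻¹ x)))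
    (h : entropy F (τ '' Set.univ) = entropy F (Set.univ : Set (G → A))) :
    IsPreInjective τ := by
  rintro z z' ⟨E, hE⟩ hzz'
  by_contra hne
  -- `D = E ∪ E S⁻¹ S` contains `E` and every window that meets `E`.
  let D : Finset G := E ∪ (E ×ˢ (S ×ˢ S)).image fun x => x.1 * x.2.1⁻¹ * x.2.2
  have hD : ∀ g, ∀ s ∈ S, g * s ∈ E → ∀ s' ∈ S, g * s' ∈ D := fun g s hs hgs s' hs' =>
    Finset.mem_union_right _ (Finset.mem_image.2 ⟨(g * s, s, s'), by simp [hgs, hs, hs'], by simp⟩)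
  have hDne : D.Nonempty := by
    obtain ⟨d, hd⟩ := Function.ne_iff.1 hne
    exact ⟨d, Finset.mem_union_left _ (by_contra fun h => hd (hE d h))⟩
  refine (hF.entropy_lt (S := S) hDne z (Set.univ_nonempty.image τ) fun T B hT => ?_).ne h
  refine le_trans (Set.ncard_le_ncard (Set.image_mono ?_)) (ncard_restrict_image_image_le hτ B _)
  rintro _ ⟨x, -, rfl⟩
  exact exists_avoiding_apply_eq hτ hzz' hE hne Finset.subset_union_left hD hT x

theorem IsFolnerSequence.entropy_eq_of_isPreInjective [Finite A] [Nonempty A]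
    (hF : IsFolnerSequence F)
    (hτ : ∀ (x : G → A) (g : G), τ x g = μ (S.restrict (shift g⁻¹ x)))
    (hpre : IsPreInjective τ) :
    entropy F (τ '' Set.univ) = entropy F (Set.univ : Set (G → A)) := by
  refine le_antisymm (entropy_mono (Set.univ_nonempty.image τ) (Set.subset_univ _)) ?_
  have hε := (hF.tendsto_boundary S).mul_const (Real.logb 2 (Nat.card A))
  rw [zero_mul] at hε
  refine limsup_coe_le_of_le_add (fun n => ?_) hε
  have hk : (0 : ℝ) < Nat.card A := by exact_mod_cast Nat.card_pos
  have hpos : (0 : ℝ) < (((F n).restrict (π := fun _ => A)) '' (τ '' Set.univ)).ncard := by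
    exact_mod_cast (Set.ncard_pos (Set.toFinite _)).2 ((Set.univ_nonempty.image τ).image _)
  have h : ((Nat.card A : ℝ)) ^ (F n).card ≤
      (((F n).restrict (π := fun _ => A)) '' (τ '' Set.univ)).ncard *
        (Nat.card A : ℝ) ^ (boundary S (F n)).card := by
    exact_mod_cast hpre.card_pow_le hτ (F n)
  have hlog := Real.logb_le_logb_of_le (b := 2) (by norm_num) (by positivity) h
  rw [Real.logb_mul hpos.ne' (by positivity), Real.logb_pow, Real.logb_pow] at hlog
  rw [ncard_restrict_image_univ, Nat.cast_pow, Real.logb_pow, div_mul_eq_mul_div, ← add_div]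
  gcongr

end Entropy

/-! ### Configurations of maximal asymptotic complexity -/

section Random

theorem ncard_programs_lt (t : ℕ) : {p : List Bool | p.length < t}.ncard < 2 ^ t := by
  induction t with
  | zero => simp
  | succ t ih =>
    have hfin := List.finite_length_lt Bool t
    have hsub : {p : List Bool | p.length < t + 1} ⊆
        insert [] (List.cons true '' {p | p.length < t} ∪ List.cons false '' {p | p.length < t}) := by
      rintro (_ | ⟨b, p⟩) hp
      · exact Set.mem_insert _ _
      · have hpt : p.length < t := by simpa using hp
        refine Set.mem_insert_of_mem _ ?_
        cases b
        · exact Or.inr ⟨p, hpt, rfl⟩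
        · exact Or.inl ⟨p, hpt, rfl⟩
    have h1 := Set.ncard_le_ncard hsub (((hfin.image _).union (hfin.image _)).insert _)
    have h2 := Set.ncard_insert_le ([] : List Bool)
      (List.cons true '' {p | p.length < t} ∪ List.cons false '' {p | p.length < t})
    have h3 := Set.ncard_union_le (List.cons true '' {p | p.length < t})
      (List.cons false '' {p | p.length < t})
    have h4 := Set.ncard_image_le (f := List.cons true) hfin
    have h5 := Set.ncard_image_le (f := List.cons false) hfin
    rw [pow_succ]
    omega

variable {G A : Type*} [DecidableEq G] {ν : G ≃ ℕ} [Finite A] [Encodable A]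
  {U : List Bool →. ℕ} {F : ℕ → Finset G}

/-- Different words on `B` have different shortest programs, and there are fewer than `2^t` programs
shorter than `t`; the letters on `B \ E` are free. -/
theorem IsOptimalDecompressor.card_pow_lt (hU : IsOptimalDecompressor U) {E B : Finset G}
    {x₀ : G → A} {t : ℕ}
    (h : ∀ x : G → A, (∀ g ∈ E, x g = x₀ g) → wordComplexity U ν x B < t) :
    Nat.card A ^ (B \ E).card < 2 ^ t := by
  let Z : Set (G → A) := {x | ∀ g ∈ E, x g = x₀ g}
  have hZ : (B \ E).restrict (π := fun _ => A) '' Z = Set.univ := by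
    refine Set.eq_univ_of_forall fun w =>
      ⟨fun g => if hg : g ∈ B \ E then w ⟨g, hg⟩ else x₀ g, fun g hg => ?_, ?_⟩
    · simp [hg]
    · funext g
      simp only [Finset.restrict, dif_pos g.2]
  have h1 : Nat.card A ^ (B \ E).card ≤ (B.restrict (π := fun _ => A) '' Z).ncard := by
    rw [← Nat.card_eq_finsetCard, ← Nat.card_fun, ← Set.ncard_univ, ← hZ]
    refine ncard_image_le_of_determines _ _ (Set.toFinite _) fun z _ z' _ hzz' => ?_
    funext g
    exact congrFun hzz' ⟨g, (Finset.mem_sdiff.1 g.2).1⟩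
  choose prog hlen hprog using fun z : G → A =>
    hU.exists_program (Encodable.encode (sortedList ν B, content ν z B))
  have hsub : prog '' Z ⊆ {p | p.length < t} := by
    rintro _ ⟨z, hz, rfl⟩
    exact (hlen z).trans_lt (h z hz)
  have hfin := List.finite_length_lt Bool t
  have h2 : (B.restrict (π := fun _ => A) '' Z).ncard ≤ (prog '' Z).ncard := by
    refine ncard_image_le_of_determines _ _ (hfin.subset hsub) fun z _ z' _ hzz' => ?_
    have := Part.mem_unique (hprog z) (hzz' ▸ hprog z')
    exact letters_sortedList_eq_iff.1 (congrArg Prod.snd (Encodable.encode_injective this))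
  exact (h1.trans (h2.trans (Set.ncard_le_ncard hsub hfin))).trans_lt (ncard_programs_lt t)

/-- Baire category in the compact space `A^G`: being nearly incompressible on some late `F n` is an
open condition, and it is dense because fixing finitely many letters leaves too many words on a
large `F n` for short programs. -/
theorem IsOptimalDecompressor.exists_logb_card_le_asymptoticComplexity
    [Nonempty A] (hU : IsOptimalDecompressor U) (hF : Tendsto (fun n => (F n).card) atTop atTop) :
    ∃ x : G → A, (Real.logb 2 (Nat.card A) : ℝ) ≤ asymptoticComplexity U ν F x := by
  let : TopologicalSpace A := ⊥
  have : DiscreteTopology A := ⟨rfl⟩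
  set κ := Real.logb 2 (Nat.card A) with hκ
  let V : ℕ → Set (G → A) := fun m => {x | ∃ n ≥ m,
    (κ - 1 / ((m : ℝ) + 1)) * (F n).card ≤ wordComplexity U ν x (F n)}
  have hopen : ∀ m, IsOpen (V m) := by
    intro m
    rw [isOpen_pi_iff]
    rintro x ⟨n, hn, hx⟩
    refine ⟨F n, fun g => {x g}, fun g _ => ⟨isOpen_discrete _, rfl⟩, fun y hy => ⟨n, hn, ?_⟩⟩
    have : content ν y (F n) = content ν x (F n) :=
      letters_sortedList_eq_iff.2 (funext fun g => hy g g.2)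
    rwa [wordComplexity, this]
  have hdense : ∀ m, Dense (V m) := by
    intro m
    rw [dense_iff_inter_open]
    rintro O hO ⟨x₀, hx₀⟩
    obtain ⟨E, u, hu, hsub⟩ := isOpen_pi_iff.1 hO x₀ hx₀
    by_contra hcon
    have hno : ∀ n ≥ m, ∀ x : G → A, (∀ g ∈ E, x g = x₀ g) →
        (wordComplexity U ν x (F n) : ℝ) < (κ - 1 / ((m : ℝ) + 1)) * (F n).card := by
      intro n hn x hx
      by_contra! hle
      exact hcon ⟨x, hsub fun g hg => by rw [hx g hg]; exact (hu g hg).2, n, hn, hle⟩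
    have hbig := (tendsto_natCast_atTop_atTop (R := ℝ)).comp hF
    -- The threshold is what contradicts `(|F n| - |E|) κ < r + 1`, which rearranges to `|F n| / (m
    -- + 1) < |E| κ + 1`.
    obtain ⟨n, hn, hnm⟩ := ((hbig.eventually_gt_atTop
      ((E.card * κ + 1) * ((m : ℝ) + 1))).and (eventually_ge_atTop m)).exists
    have hno := hno n hnm
    set r := (κ - 1 / ((m : ℝ) + 1)) * (F n).card with hr
    have hr0 : 0 ≤ r := (Nat.cast_nonneg _).trans (hno x₀ fun _ _ => rfl).le
    have hcount := hU.card_pow_lt (ν := ν) (B := F n) (E := E) (x₀ := x₀) (t := ⌈r⌉₊)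
      fun x hx => Nat.lt_ceil.2 (hno x hx)
    have hk : (1 : ℝ) ≤ Nat.card A := by exact_mod_cast Nat.card_pos
    have hκ0 : 0 ≤ κ := Real.logb_nonneg (by norm_num) hk
    have hcount' : (Nat.card A : ℝ) ^ (F n \ E).card ≤ 2 ^ ⌈r⌉₊ := by exact_mod_cast hcount.le
    have hlog := Real.logb_le_logb_of_le (b := 2) (by norm_num) (by positivity) hcount'
    rw [Real.logb_pow, Real.logb_pow, Real.logb_self_eq_one (by norm_num), mul_one] at hlog
    have hceil := Nat.ceil_lt_add_one hr0
    have hcard : ((F n).card : ℝ) - E.card ≤ (F n \ E).card := by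
      rw [sub_le_iff_le_add]
      have := Finset.le_card_sdiff E (F n)
      exact_mod_cast (by omega : (F n).card ≤ (F n \ E).card + E.card)
    have h1 : (((F n).card : ℝ) - E.card) * κ < r + 1 :=
      (mul_le_mul_of_nonneg_right hcard hκ0).trans_lt (hlog.trans_lt hceil)
    have h2 : ((F n).card : ℝ) / ((m : ℝ) + 1) < E.card * κ + 1 := by
      have : r = κ * (F n).card - (F n).card / ((m : ℝ) + 1) := by rw [hr]; ring
      linarith
    rw [div_lt_iff₀ (by positivity)] at h2
    exact lt_asymm hn h2
  obtain ⟨x, hx⟩ := (dense_iInter_of_isOpen hopen hdense).nonempty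
  rw [Set.mem_iInter] at hx
  refine ⟨x, ?_⟩
  by_contra! hlt
  obtain ⟨a, ha1, ha2⟩ := EReal.lt_iff_exists_real_btwn.1 hlt
  rw [EReal.coe_lt_coe_iff] at ha2
  refine not_le_of_gt ha1 (le_limsup_of_frequently_le (frequently_atTop.2 fun N => ?_))
  obtain ⟨M, hM⟩ := exists_nat_one_div_lt (sub_pos.2 ha2)
  obtain ⟨M', hM'⟩ := eventually_atTop.1 (hF.eventually_gt_atTop 0)
  -- `M` makes the defect smaller than `κ - a`, `N` makes `n` late enough, and `M'` makes `F n`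
  -- nonempty.
  obtain ⟨n, hn, hle⟩ := hx (max (max M N) M')
  refine ⟨n, by omega, EReal.coe_le_coe_iff.2 ?_⟩
  have hpos : (0 : ℝ) < (F n).card := by exact_mod_cast hM' n (by omega)
  rw [le_div_iff₀ hpos]
  refine le_trans (mul_le_mul_of_nonneg_right ?_ hpos.le) hle
  have : 1 / (((max (max M N) M' : ℕ) : ℝ) + 1) ≤ 1 / ((M : ℝ) + 1) :=
    one_div_le_one_div_of_le (by positivity)
      (by gcongr; exact (le_max_left _ _).trans (le_max_left _ _))
  linarith

end Random

/-! ### Asymptotic complexity of images -/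

section Image

variable {G A : Type*} [Group G] [DecidableEq G] {ν : G ≃ ℕ} [Finite A] [Nonempty A] [Encodable A]
  {U : List Bool →. ℕ} {F : ℕ → Finset G} {τ : (G → A) → (G → A)}

theorem clog_card_pow_le (k e : ℕ) : Nat.clog 2 (k ^ e) ≤ e * Nat.clog 2 k := by
  refine Nat.clog_le_of_le_pow ?_
  rw [mul_comm, pow_mul]
  exact Nat.pow_le_pow_left (Nat.le_pow_clog (by norm_num) k) e

/-- An index among `k^|∂_S (F n)|` candidates costs `O(|∂_S (F n)|) = o(|F n|)` bits; the constant
disappears because `|F n| → ∞`. -/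
theorem IsFolnerSequence.limsup_le_of_boundary [Infinite G] (hF : IsFolnerSequence F)
    {u v : ℕ → ℕ} {S : Finset G} {k c : ℕ}
    (h : ∀ n, ∃ N ≤ k ^ (boundary S (F n)).card, u n ≤ v n + 2 * Nat.clog 2 N + c) :
    limsup (fun n => (((u n : ℝ) / (F n).card : ℝ) : EReal)) atTop ≤
      limsup (fun n => (((v n : ℝ) / (F n).card : ℝ) : EReal)) atTop := by
  have hε := ((hF.tendsto_boundary S).const_mul (2 * (Nat.clog 2 k : ℝ))).add
    (hF.tendsto_const_div c)
  rw [mul_zero, zero_add] at hε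
  refine limsup_coe_le_of_le_add (fun n => ?_) hε
  obtain ⟨N, hN, hle⟩ := h n
  have hclog := (Nat.clog_mono_right 2 hN).trans (clog_card_pow_le k (boundary S (F n)).card)
  have : u n ≤ v n + (2 * Nat.clog 2 k * (boundary S (F n)).card + c) := by
    linarith
  rw [← mul_div_assoc, ← add_div, ← add_div]
  gcongr
  exact_mod_cast this

theorem IsFolnerSequence.asymptoticComplexity_image_le [Infinite G] (hF : IsFolnerSequence F)
    (hG : IsComputableGroup G ν) (hU : IsOptimalDecompressor U) (hτ : IsCellularAutomaton τ)
    (x : G → A) : asymptoticComplexity U ν F (τ x) ≤ asymptoticComplexity U ν F x := by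
  obtain ⟨c, hc⟩ := exists_wordComplexity_image_le hG hU hτ
  obtain ⟨S, μ, hμ⟩ := hτ
  exact hF.limsup_le_of_boundary fun n => ⟨_, ncard_image_words_le hμ (F n) x, hc (F n) x⟩

theorem IsFolnerSequence.le_asymptoticComplexity_image [Infinite G] (hF : IsFolnerSequence F)
    (hG : IsComputableGroup G ν) (hU : IsOptimalDecompressor U) (hτ : IsCellularAutomaton τ)
    (hpre : IsPreInjective τ) (x : G → A) :
    asymptoticComplexity U ν F x ≤ asymptoticComplexity U ν F (τ x) := by
  obtain ⟨c, hc⟩ := exists_wordComplexity_le_image hG hU hτ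
  obtain ⟨S, μ, hμ⟩ := hτ
  exact hF.limsup_le_of_boundary fun n => ⟨_, hpre.ncard_words_le hμ (F n) x, hc (F n) x⟩

theorem IsModestFolnerSequence.asymptoticComplexity_image_le_entropy [Infinite G]
    (hF : IsModestFolnerSequence U ν F) (hG : IsComputableGroup G ν)
    (hU : IsOptimalDecompressor U) (hτ : IsCellularAutomaton τ) (x : G → A) :
    asymptoticComplexity U ν F (τ x) ≤ entropy F (τ '' Set.univ) := by
  obtain ⟨c, hc⟩ := exists_wordComplexity_image_le_clog hG hU hτ
  -- The extra `1` pays for rounding the logarithm up; `hF.2` is modesty.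
  have hε := (hF.2.const_mul 2).add (hF.1.tendsto_const_div (c + 1))
  rw [mul_zero, zero_add] at hε
  refine limsup_coe_le_of_le_add (fun n => ?_) hε
  have hpos : 0 < (((F n).restrict (π := fun _ => A)) '' (τ '' Set.univ)).ncard :=
    (Set.ncard_pos (Set.toFinite _)).2 ((Set.univ_nonempty.image τ).image _)
  have h := hc (F n) x
  set N := (((F n).restrict (π := fun _ => A)) '' (τ '' Set.univ)).ncard
  have hlog : (Nat.clog 2 N : ℝ) ≤ Real.logb 2 N + 1 := by
    rw [← Real.natCeil_logb_natCast]
    exact (Nat.ceil_lt_add_one (Real.logb_nonneg (by norm_num) (by exact_mod_cast hpos))).le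
  have h' : (wordComplexity U ν (τ x) (F n) : ℝ) ≤
      2 * setComplexity U ν (F n) + Nat.clog 2 N + c := by exact_mod_cast h
  rw [← mul_div_assoc, ← add_div, ← add_div]
  gcongr
  linarith

end Image

end AsymptoticComplexity

/-! ### The equivalence of the four properties -/

theorem mainTheorem1 {G : Type*} [Group G] [DecidableEq G] (ν : G ≃ ℕ)
    (hG : AsymptoticComplexity.IsComputableGroup G ν)
    {A : Type*} [Finite A] [Encodable A]
    (U : List Bool →. ℕ) (hU : AsymptoticComplexity.IsOptimalDecompressor U)
    (F : ℕ → Finset G) (hF : AsymptoticComplexity.IsModestFolnerSequence U ν F)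
    (τ : (G → A) → (G → A)) (hτ : AsymptoticComplexity.IsCellularAutomaton τ) :
    List.TFAE [
      ¬ ∃ x : G → A, AsymptoticComplexity.IsGardenOfEden τ x,
      AsymptoticComplexity.IsPreInjective τ,
      AsymptoticComplexity.entropy F (τ '' Set.univ) =
        AsymptoticComplexity.entropy F (Set.univ : Set (G → A)),
      ∀ x : G → A, AsymptoticComplexity.asymptoticComplexity U ν F (τ x) =
        AsymptoticComplexity.asymptoticComplexity U ν F x] := by
  have : Infinite G := Infinite.of_injective ν.symm ν.symm.injective
  -- For empty `A` there are no configurations, and all four statements hold trivially.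
  rcases isEmpty_or_nonempty A with hA | hA
  · have hE : IsEmpty (G → A) := ⟨fun x => isEmptyElim (x 1)⟩
    refine List.tfae_of_forall True _ fun a ha => iff_true_intro ?_
    simp only [List.mem_cons, List.not_mem_nil, or_false] at ha
    rcases ha with rfl | rfl | rfl | rfl
    · exact fun ⟨x, _⟩ => isEmptyElim x
    · exact fun x => isEmptyElim x
    · rw [Subsingleton.elim (τ '' Set.univ) Set.univ]
    · exact fun x => isEmptyElim x
  obtain ⟨S, μ, hμ⟩ := id hτ
  tfae_have 1 → 3 := fun h => by
    rw [Set.image_univ, Set.range_eq_univ.2 fun x => ?_]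
    by_contra hx
    exact h ⟨x, Set.eq_empty_of_forall_notMem fun y hy => hx ⟨y, hy⟩⟩
  tfae_have 3 → 1 := fun h ⟨x, hx⟩ => by
    obtain ⟨y, hy⟩ := hF.1.surjective_of_entropy_eq hμ h x
    exact Set.eq_empty_iff_forall_notMem.1 hx y hy
  tfae_have 3 → 2 := hF.1.isPreInjective_of_entropy_eq hμ
  tfae_have 2 → 4 := fun h x => le_antisymm (hF.1.asymptoticComplexity_image_le hG hU hτ x)
    (hF.1.le_asymptoticComplexity_image hG hU hτ h x)
  tfae_have 2 → 3 := hF.1.entropy_eq_of_isPreInjective hμ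
  tfae_have 4 → 3 := fun h => by
    refine le_antisymm (AsymptoticComplexity.entropy_mono (Set.univ_nonempty.image τ) (Set.subset_univ _)) ?_
    obtain ⟨x, hx⟩ := hU.exists_logb_card_le_asymptoticComplexity (A := A) (ν := ν)
      hF.1.tendsto_card
    rw [AsymptoticComplexity.entropy_univ hF.1.1]
    exact (hx.trans (h x).ge).trans
      (hF.asymptoticComplexity_image_le_entropy hG hU hτ x)
  tfae_finish
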